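/- **Setting.** Let $\mathcal E$ be a finite set of facilities, $C_0\in\mathbb R$ the usage cost before an attack, $C_e\in\mathbb R$ the usage cost when $e\in\mathcal E$ is compromised, $c_a>0$ the cost of an attack and $c_d>0$ the cost of securing one facility. The defender chooses $s_d\subseteq\mathcal E$, the attacker chooses $s_a\in\mathcal E\cup\{\emptyset\}$ ($\emptyset$ means no attack). The usage cost is $C(s_d,s_a)=C_e$ if $s_a=e\notin s_d$ and $C(s_d,s_a)=C_0$ otherwise; the utilities are $u_d=-C(s_d,s_a)-c_d|s_d|$ and $u_a=C(s_d,s_a)-c_a\mathbf 1\{s_a\neq\emptyset\}$, and $U_d,U_a$ are their expectations under mixed strategies $\sigma_d\in\Delta(2^{\mathcal E})$, $\sigma_a\in\Delta(\mathcal E\cup\{\emptyset\})$. The effort vector of $\sigma_d$ is $\rho_e=\sum_{s_d\ni e}\sigma_d(s_d)$, $e\in\mathcal E$. In the sequential game the defender moves first and the attacker's strategy is a map $\tilde\sigma_a:\Delta(2^{\mathcal E})\to\Delta(\mathcal E\cup\{\emptyset\})$. Let $BR(\sigma_d)$ be the set of maximizers of $U_a(\sigma_d,\cdot)$. A pair $(\tilde\sigma_d^*,\tilde\sigma_a^*)$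 is a subgame perfect equilibrium (SPE) if $\tilde\sigma_a^*(\sigma_d)\in BR(\sigma_d)$ for every $\sigma_d$, and $U_d(\tilde\sigma_d^*,\tilde\sigma_a^*(\tilde\sigma_d^*))\ge U_d(\sigma_d,\tilde\sigma_a^*(\sigma_d))$ for every $\sigma_d$. Write $\tilde\rho^*$ for the effort vector of $\tilde\sigma_d^*$. Assume $\bar{\mathcal E}=\{e: C_e>C_0\}\ne\emptyset$. Let $C_{(1)}>\dots>C_{(K)}$ be the distinct values of $C_e$, $e\in\bar{\mathcal E}$, put $C_{(K+1)}:=C_0$, $\bar{\mathcal E}_{(k)}=\{e\in\bar{\mathcal E}: C_e=C_{(k)}\}$, $E_{(k)}=|\bar{\mathcal E}_{(k)}|$ and $S_i=\sum_{k=1}^{i}\frac{E_{(k)}}{C_{(k)}-C_0}$. For $1\le j\le i\le K$ let $$c_d^{ij}(x)=\frac{C_{(j)}-C_0}{(C_{(j)}-C_0)\,S_{j-1}+\sum_{k=j}^{i}E_{(k)}-x\,S_i}\qquad(S_0=0),$$ and for $0\le x<C_{(1)}-C_0$ let $\tilde c_d(x)=c_d^{ij}(x)$, where $1\le j\le i\le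 K$ is the unique pair with $C_{(i+1)}-C_0\le x<C_{(i)}-C_0$ and $\frac1{S_i}\sum_{k=j+1}^{i}E_{(k)}\le x<\frac1{S_i}\sum_{k=j}^{i}E_{(k)}$. Let $\tilde c_d^{-1}$ be the inverse function of $\tilde c_d$. The regimes are the following. - Type $\tilde{\mathrm I}$: regime $\tilde\Lambda_0$: $c_a>C_{(1)}-C_0$, $c_d>0$; regime $\tilde\Lambda_i$, $1\le i\le K$: $C_{(i+1)}-C_0<c_a<C_{(i)}-C_0$ and $0<c_d<\tilde c_d(c_a)$. - Type $\widetilde{\mathrm{II}}$: regime $\tilde\Lambda^j$, $1\le j\le K$: $0<c_a<\tilde c_d^{-1}(c_d)$, $c_d>S_j^{-1}$ and, if $j\ge2$, $c_d<S_{j-1}^{-1}$. **Theorem 2.** In each regime an SPE exists and the defender's effort vector $\tilde\rho^*$ is the same in all SPE. Moreover $(\tilde\sigma_d^*,\tilde\sigma_a^*)$ is an SPE if and only if: 1. in $\tilde\Lambda_0$: $\tilde\rho^*_e=0$ for all $e\in\mathcal E$, and $\tilde\sigma_a^*(\sigma_d)$ is "no attack" with probability $1$ for every $\sigma_d$; 2.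 in $\tilde\Lambda_i$, $1\le i\le K$: $\tilde\rho^*_e=\frac{C_{(k)}-c_a-C_0}{C_{(k)}-C_0}$ for $e\in\bar{\mathcal E}_{(k)}$, $k=1,\dots,i$, and $\tilde\rho^*_e=0$ for all other $e$; $\tilde\sigma_a^*(\tilde\sigma_d^*)$ is "no attack" with probability $1$; and $\tilde\sigma_a^*(\sigma_d)\in BR(\sigma_d)$ for all $\sigma_d\ne\tilde\sigma_d^*$; 3. in $\tilde\Lambda^1$: $\tilde\rho^*_e=0$ for all $e\in\mathcal E$; $\tilde\sigma_a^*(\tilde\sigma_d^*)\in\Delta(\bar{\mathcal E}_{(1)})$; and $\tilde\sigma_a^*(\sigma_d)\in BR(\sigma_d)$ for all $\sigma_d\ne\tilde\sigma_d^*$; 4. in $\tilde\Lambda^j$, $2\le j\le K$: $\tilde\rho^*_e=\frac{C_{(k)}-C_{(j)}}{C_{(k)}-C_0}$ for $e\in\bar{\mathcal E}_{(k)}$, $k=1,\dots,j-1$, and $\tilde\rho^*_e=0$ for all other $e$; $\tilde\sigma_a^*(\tilde\sigma_d^*)\in\Delta\big(\bigcup_{k=1}^{j}\bar{\mathcal E}_{(k)}\big)$;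 and $\tilde\sigma_a^*(\sigma_d)\in BR(\sigma_d)$ for all $\sigma_d\ne\tilde\sigma_d^*$. In 3 and 4 the total attack probability is thus $1$; moreover, in the type $\widetilde{\mathrm{II}}$ regimes the set of effort vectors of the defender in SPE coincides with the set of effort vectors of the defender in Nash equilibria of the simultaneous-move game with the same utilities. -/

import Mathlib

/-!
Attacker-defender security game on a finite set `E` of facilities.
Parameters: `C0` is the usage cost before an attack, `C e` the usage cost if `e` is compromised,
`ca` the cost of an attack and `cd` the cost of securing one facility.
-/

namespace SecurityGame

noncomputable section

/-! ### The game -/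

/-- Mixed strategies of the defender: probability distributions over the subsets of `E`. -/
abbrev DefStrategy (E : Type*) [Fintype E] : Type _ := ↥(stdSimplex ℝ (Finset E))

/-- Mixed strategies of the attacker: probability distributions over `E ∪ {∅}`; the action
`none` is "no attack" and `some e` is "target `e`". -/
abbrev AttStrategy (E : Type*) [Fintype E] : Type _ := ↥(stdSimplex ℝ (Option E))

/-- Usage cost after the interaction, for a pure strategy profile. -/
def usageCost {E : Type*} [DecidableEq E] (C0 : ℝ) (C : E → ℝ) (S : Finset E) :
    Option E → ℝ
  | none => C0
  | some e => if e ∈ S then C0 else C e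

/-- Defender's utility of a pure strategy profile. -/
def pureUd {E : Type*} [DecidableEq E] (C0 : ℝ) (C : E → ℝ) (cd : ℝ) (S : Finset E)
    (a : Option E) : ℝ :=
  -usageCost C0 C S a - cd * (S.card : ℝ)

/-- Attacker's utility of a pure strategy profile. -/
def pureUa {E : Type*} [DecidableEq E] (C0 : ℝ) (C : E → ℝ) (ca : ℝ) (S : Finset E)
    (a : Option E) : ℝ :=
  usageCost C0 C S a - ca * (if a = none then 0 else 1)

/-- Defender's expected utility of a mixed strategy profile. -/
def Ud {E : Type*} [Fintype E] [DecidableEq E] (C0 : ℝ) (C : E → ℝ) (cd : ℝ)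
    (σd : DefStrategy E) (σa : AttStrategy E) : ℝ :=
  ∑ S : Finset E, ∑ a : Option E, pureUd C0 C cd S a * σa.1 a * σd.1 S

/-- Attacker's expected utility of a mixed strategy profile. -/
def Ua {E : Type*} [Fintype E] [DecidableEq E] (C0 : ℝ) (C : E → ℝ) (ca : ℝ)
    (σd : DefStrategy E) (σa : AttStrategy E) : ℝ :=
  ∑ S : Finset E, ∑ a : Option E, pureUa C0 C ca S a * σa.1 a * σd.1 S

/-- Security effort vector of a defender's mixed strategy: `effort σd e` is the probability
that facility `e` is secured. -/
def effort {E : Type*} [Fintype E] [DecidableEq E] (σd : DefStrategy E) (e : E) : ℝ :=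
  ∑ S : Finset E with e ∈ S, σd.1 S

/-- The attacker's best responses to a strategy of the defender. -/
def BR {E : Type*} [Fintype E] [DecidableEq E] (C0 : ℝ) (C : E → ℝ) (ca : ℝ)
    (σd : DefStrategy E) : Set (AttStrategy E) :=
  {τ | ∀ τ' : AttStrategy E, Ua C0 C ca σd τ' ≤ Ua C0 C ca σd τ}

/-- Nash equilibria of the simultaneous-move game. -/
def IsNE {E : Type*} [Fintype E] [DecidableEq E] (C0 : ℝ) (C : E → ℝ) (ca cd : ℝ)
    (σd : DefStrategy E) (σa : AttStrategy E) : Prop :=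
  (∀ σd' : DefStrategy E, Ud C0 C cd σd' σa ≤ Ud C0 C cd σd σa) ∧
  (∀ σa' : AttStrategy E, Ua C0 C ca σd σa' ≤ Ua C0 C ca σd σa)

/-- Subgame perfect equilibria of the sequential game, in which the defender moves first and a
strategy of the attacker is a map from the strategies of the defender to `AttStrategy E`. -/
def IsSPE {E : Type*} [Fintype E] [DecidableEq E] (C0 : ℝ) (C : E → ℝ) (ca cd : ℝ)
    (σd : DefStrategy E) (σa : DefStrategy E → AttStrategy E) : Prop :=
  (∀ σd' : DefStrategy E, Ud C0 C cd σd' (σa σd') ≤ Ud C0 C cd σd (σa σd)) ∧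
  (∀ (σd' : DefStrategy E) (τ : AttStrategy E),
    Ua C0 C ca σd' τ ≤ Ua C0 C ca σd' (σa σd'))

/-- The set of the defender's security effort vectors in Nash equilibria. -/
def neEfforts {E : Type*} [Fintype E] [DecidableEq E] (C0 : ℝ) (C : E → ℝ) (ca cd : ℝ) :
    Set (E → ℝ) :=
  {ρ | ∃ (σd : DefStrategy E) (σa : AttStrategy E), IsNE C0 C ca cd σd σa ∧ effort σd = ρ}

/-- The set of the defender's security effort vectors in subgame perfect equilibria. -/
def speEfforts {E : Type*} [Fintype E] [DecidableEq E] (C0 : ℝ) (C : E → ℝ) (ca cd : ℝ) :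
    Set (E → ℝ) :=
  {ρ | ∃ (σd : DefStrategy E) (σa : DefStrategy E → AttStrategy E),
    IsSPE C0 C ca cd σd σa ∧ effort σd = ρ}

/-- `τ ∈ Δ(A)`: the attacker targets a facility of `A` with probability one. -/
def AttacksWithin {E : Type*} [Fintype E] (τ : AttStrategy E) (A : Finset E) : Prop :=
  τ.1 none = 0 ∧ ∀ e, e ∉ A → τ.1 (some e) = 0

/-! ### Ordering of the facilities by usage cost -/

/-- The facilities whose damage increases the usage cost. -/
def Ebar {E : Type*} [Fintype E] (C0 : ℝ) (C : E → ℝ) : Finset E :=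
  {e : E | C0 < C e}

/-- The set of distinct values of `C` on `Ebar`. -/
def costValues {E : Type*} [Fintype E] (C0 : ℝ) (C : E → ℝ) : Finset ℝ :=
  (Ebar C0 C).image C

/-- The number `K` of distinct values of `C` on `Ebar`. -/
def numValues {E : Type*} [Fintype E] (C0 : ℝ) (C : E → ℝ) : ℕ :=
  (costValues C0 C).card

/-- `C_(k)`, the `k`-th highest distinct value of `C` on `Ebar`, for `k = 1, …, K`, with the
convention `C_(K+1) = C0` (the value at `k = 0` is never used). -/
def ordCost {E : Type*} [Fintype E] (C0 : ℝ) (C : E → ℝ) (k : ℕ) : ℝ :=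
  ((costValues C0 C).sort (· ≥ ·)).getD (k - 1) C0

/-- The group of facilities in `Ebar` with usage cost `C_(k)`. -/
def group {E : Type*} [Fintype E] (C0 : ℝ) (C : E → ℝ) (k : ℕ) : Finset E :=
  {e ∈ Ebar C0 C | C e = ordCost C0 C k}

/-- `E_(k)`, the number of facilities in the `k`-th group. -/
def groupCard {E : Type*} [Fintype E] (C0 : ℝ) (C : E → ℝ) (k : ℕ) : ℝ :=
  ((group C0 C k).card : ℝ)

/-- The facilities in the groups `1, …, i`. -/
def topGroups {E : Type*} [Fintype E] [DecidableEq E] (C0 : ℝ) (C : E → ℝ) (i : ℕ) :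
    Finset E :=
  (Finset.Icc 1 i).biUnion (group C0 C)

/-- `∑_{k=1}^{i} E_(k) / (C_(k) - C0)`. -/
def invSum {E : Type*} [Fintype E] (C0 : ℝ) (C : E → ℝ) (i : ℕ) : ℝ :=
  ∑ k ∈ Finset.Icc 1 i, groupCard C0 C k / (ordCost C0 C k - C0)

/-! ### The threshold defense cost and the regimes -/

/-- The functions `c_d^{ij}` of the attack cost `x`, for `1 ≤ j ≤ i ≤ K`. -/
def cdij {E : Type*} [Fintype E] (C0 : ℝ) (C : E → ℝ) (i j : ℕ) (x : ℝ) : ℝ :=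
  if j = 1 then
    (ordCost C0 C 1 - C0) /
      (∑ k ∈ Finset.Icc 1 i, groupCard C0 C k
        - ∑ k ∈ Finset.Icc 1 i, x * groupCard C0 C k / (ordCost C0 C k - C0))
  else
    (ordCost C0 C j - C0) /
      ((ordCost C0 C j - C0)
          * (∑ k ∈ Finset.Icc 1 (j - 1), groupCard C0 C k / (ordCost C0 C k - C0))
        + ∑ k ∈ Finset.Icc j i, groupCard C0 C k
        - ∑ k ∈ Finset.Icc 1 i, x * groupCard C0 C k / (ordCost C0 C k - C0))

/-- The piece of the attack-cost axis, indexed by `1 ≤ j ≤ i ≤ K`, on which the threshold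
defense cost is given by `c_d^{ij}`. -/
def InPiece {E : Type*} [Fintype E] (C0 : ℝ) (C : E → ℝ) (i j : ℕ) (x : ℝ) : Prop :=
  (ordCost C0 C (i + 1) - C0 ≤ x ∧ x < ordCost C0 C i - C0) ∧
  ((∑ k ∈ Finset.Icc (j + 1) i, groupCard C0 C k) / invSum C0 C i ≤ x ∧
    x < (∑ k ∈ Finset.Icc j i, groupCard C0 C k) / invSum C0 C i)

open Classical in
/-- The threshold defense cost as a function of the attack cost `x`, `0 ≤ x < C_(1) - C0`: it
is `c_d^{ij}(x)` for the only pair `1 ≤ j ≤ i ≤ K` such that `x` is in the piece of `(i, j)`. -/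
def cdTilde {E : Type*} [Fintype E] (C0 : ℝ) (C : E → ℝ) (x : ℝ) : ℝ :=
  ∑ i ∈ Finset.Icc 1 (numValues C0 C), ∑ j ∈ Finset.Icc 1 i,
    if InPiece C0 C i j x then cdij C0 C i j x else 0

/-- The inverse of the threshold `cdTilde`, which is a function on `[0, C_(1) - C0)`. -/
def cdTildeInv {E : Type*} [Fintype E] (C0 : ℝ) (C : E → ℝ) (y : ℝ) : ℝ :=
  Function.invFunOn (cdTilde C0 C) (Set.Ico 0 (ordCost C0 C 1 - C0)) y

/-- The regime `i = 0` of the first type. -/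
def RegimeOneZero {E : Type*} [Fintype E] (C0 : ℝ) (C : E → ℝ) (ca cd : ℝ) : Prop :=
  ordCost C0 C 1 - C0 < ca ∧ 0 < cd

/-- The regimes `i = 1, …, K` of the first type (for `i = K` the lower bound on `ca` is `0`). -/
def RegimeOne {E : Type*} [Fintype E] (C0 : ℝ) (C : E → ℝ) (i : ℕ) (ca cd : ℝ) : Prop :=
  (ordCost C0 C (i + 1) - C0 < ca ∧ ca < ordCost C0 C i - C0) ∧
  (0 < cd ∧ cd < cdTilde C0 C ca)

/-- The regimes `j = 1, …, K` of the second type. -/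
def RegimeTwo {E : Type*} [Fintype E] (C0 : ℝ) (C : E → ℝ) (j : ℕ) (ca cd : ℝ) : Prop :=
  (0 < ca ∧ ca < cdTildeInv C0 C cd) ∧
  ((invSum C0 C j)⁻¹ < cd ∧ (2 ≤ j → cd < (invSum C0 C (j - 1))⁻¹))

end

end SecurityGame

/-! A mixed defense matters only through its effort vector, and every vector of the unit cube is one
(`exists_effort_eq`). For efforts `ρ`, let `t` be the largest `(1 - ρ e) * (C e - C0)`. A
best-responding attacker stays away if `t < ca` and surely causes the loss `t` if `t > ca`
(`expLoss_eq_zero_of_lt`, `exists_threat_of_mem_BR`). Holding the threat at `t` takes total effort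
at least `N(t) = minTotal C0 C t`, attained only by `minEffort C0 C t`. So the defender compares
deterrence, at cost `cd * N(ca)`, with tolerance, at cost `min_t (t + cd * N(t))`. The attacker is
indifferent at `t = ca`, but thresholds just below `ca` bound the defender's equilibrium cost by `cd
* N(ca)`; this forces no attack on the path when deterrence is cheaper.

`N` is convex, decreasing and piecewise linear, with slope `-S_i` between `C_(i+1) - C0` and `C_(i)
- C0`; hence `t + cd * N(t)` is least at `C_(j) - C0` when `1/S_j ≤ cd ≤ 1/S_{j-1}`. This is proved
by duality instead of convexity. `IsCertificate` describes attack probabilities that make no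
facility worth more than `cd` to secure; nonnegative slacks (`sum_slack`) give optimality, and
strict inequalities give uniqueness. The same probabilities are an attacker strategy in a Nash
equilibrium, which is why the two games have the same efforts in the second type of regime.

Finally `cdTilde C0 C x` is the `c` at which `c * N(x) = min_t (t + c * N(t))` (`cdTilde_spec`).
Below it deterrence wins strictly (`deterrence_of_lt_cdTilde`); for `ca` below its inverse,
tolerance does (`RegimeTwo.tolerance`). -/

namespace SecurityGame

/-! ### Reduction to effort vectors; best responses of the attacker -/

section Game

variable {E : Type*} [Fintype E]

/-- The attacker's expected gain from an action, relative to `C0`, against an effort vector. -/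
noncomputable def attackGain (C0 : ℝ) (C : E → ℝ) (ca : ℝ) (ρ : E → ℝ) : Option E → ℝ
  | none => 0
  | some e => (1 - ρ e) * (C e - C0) - ca

/-- The expected increase of the usage cost. -/
noncomputable def expLoss (C0 : ℝ) (C : E → ℝ) (ρ : E → ℝ) (τ : AttStrategy E) : ℝ :=
  ∑ e, τ.1 (some e) * ((1 - ρ e) * (C e - C0))

lemma AttStrategy.sum_some (τ : AttStrategy E) : ∑ e, τ.1 (some e) = 1 - τ.1 none := by
  have := τ.2.2
  rw [Fintype.sum_option] at this
  linarith

lemma AttStrategy.none_le_one (τ : AttStrategy E) : τ.1 none ≤ 1 := by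
  have := τ.sum_some
  have h : 0 ≤ ∑ e, τ.1 (some e) := Finset.sum_nonneg fun e _ => τ.2.1 _
  linarith

lemma sum_attackGain (C0 : ℝ) (C : E → ℝ) (ca : ℝ) (ρ : E → ℝ) (τ : AttStrategy E) :
    ∑ a, τ.1 a * attackGain C0 C ca ρ a = expLoss C0 C ρ τ - ca * (1 - τ.1 none) := by
  rw [Fintype.sum_option, ← τ.sum_some, expLoss, Finset.mul_sum, ← Finset.sum_sub_distrib]
  simp only [attackGain, mul_zero, zero_add]
  exact Finset.sum_congr rfl fun a _ => by ring

lemma expLoss_le {C0 : ℝ} {C : E → ℝ} {ρ : E → ℝ} {t : ℝ}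
    (h : ∀ e, (1 - ρ e) * (C e - C0) ≤ t) (τ : AttStrategy E) :
    expLoss C0 C ρ τ ≤ t * (1 - τ.1 none) := by
  rw [← τ.sum_some, Finset.mul_sum]
  exact Finset.sum_le_sum fun e _ => by
    rw [mul_comm t]
    exact mul_le_mul_of_nonneg_left (h e) (τ.2.1 _)

lemma expLoss_eq_zero {C0 : ℝ} {C : E → ℝ} {ρ : E → ℝ} {τ : AttStrategy E}
    (h : τ.1 none = 1) : expLoss C0 C ρ τ = 0 := by
  have h1 := τ.sum_some
  rw [h, sub_self, Finset.sum_eq_zero_iff_of_nonneg fun e _ => τ.2.1 _] at h1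
  exact Finset.sum_eq_zero fun e he => by rw [h1 e he, zero_mul]

variable [DecidableEq E]

lemma effort_eq_sum_ite (σd : DefStrategy E) (e : E) :
    effort σd e = ∑ S : Finset E, if e ∈ S then σd.1 S else 0 := by
  rw [effort, Finset.sum_filter]

lemma effort_nonneg (σd : DefStrategy E) (e : E) : 0 ≤ effort σd e :=
  Finset.sum_nonneg fun S _ => σd.2.1 S

lemma effort_le_one (σd : DefStrategy E) (e : E) : effort σd e ≤ 1 := by
  rw [← σd.2.2, effort]
  exact Finset.sum_le_sum_of_subset_of_nonneg (Finset.filter_subset _ _) fun S _ _ => σd.2.1 S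

lemma sum_usageCost (C0 : ℝ) (C : E → ℝ) (σd : DefStrategy E) (e : E) :
    ∑ S : Finset E, usageCost C0 C S (some e) * σd.1 S
      = C0 + (1 - effort σd e) * (C e - C0) := by
  have h : ∀ S : Finset E, usageCost C0 C S (some e) * σd.1 S
      = C e * σd.1 S - (C e - C0) * (if e ∈ S then σd.1 S else 0) := by
    intro S
    simp only [usageCost]
    split_ifs <;> ring
  rw [Finset.sum_congr rfl fun S _ => h S, Finset.sum_sub_distrib, ← Finset.mul_sum,
    ← Finset.mul_sum, ← effort_eq_sum_ite, σd.2.2]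
  ring

lemma sum_card_mul (σd : DefStrategy E) :
    ∑ S : Finset E, (S.card : ℝ) * σd.1 S = ∑ e, effort σd e := by
  simp_rw [effort_eq_sum_ite]
  rw [Finset.sum_comm]
  refine Finset.sum_congr rfl fun S _ => ?_
  simp

lemma sum_sum_usageCost (C0 : ℝ) (C : E → ℝ) (σd : DefStrategy E) (τ : AttStrategy E) :
    ∑ S : Finset E, ∑ a : Option E, usageCost C0 C S a * τ.1 a * σd.1 S
      = C0 + expLoss C0 C (effort σd) τ := by
  rw [Finset.sum_comm]
  have h : ∀ a : Option E, ∑ S : Finset E, usageCost C0 C S a * τ.1 a * σd.1 S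
      = τ.1 a * ∑ S : Finset E, usageCost C0 C S a * σd.1 S := by
    intro a
    rw [Finset.mul_sum]
    exact Finset.sum_congr rfl fun S _ => by ring
  rw [Finset.sum_congr rfl fun a _ => h a, Fintype.sum_option]
  simp_rw [sum_usageCost]
  simp only [usageCost, ← Finset.mul_sum, σd.2.2, mul_add, Finset.sum_add_distrib,
    ← Finset.sum_mul, τ.sum_some, expLoss]
  ring

lemma Ud_eq (C0 : ℝ) (C : E → ℝ) (cd : ℝ) (σd : DefStrategy E) (τ : AttStrategy E) :
    Ud C0 C cd σd τ = -C0 - expLoss C0 C (effort σd) τ - cd * ∑ e, effort σd e := by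
  have h : ∀ S : Finset E, ∑ a : Option E, pureUd C0 C cd S a * τ.1 a * σd.1 S
      = -(∑ a : Option E, usageCost C0 C S a * τ.1 a * σd.1 S)
        - cd * ((S.card : ℝ) * σd.1 S) := by
    intro S
    have : cd * ((S.card : ℝ) * σd.1 S)
        = ∑ a : Option E, τ.1 a * (cd * ((S.card : ℝ) * σd.1 S)) := by
      rw [← Finset.sum_mul, τ.2.2, one_mul]
    rw [this, ← Finset.sum_neg_distrib, ← Finset.sum_sub_distrib]
    exact Finset.sum_congr rfl fun a _ => by rw [pureUd]; ring
  rw [Ud, Finset.sum_congr rfl fun S _ => h S, Finset.sum_sub_distrib, Finset.sum_neg_distrib,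
    sum_sum_usageCost, ← Finset.mul_sum, sum_card_mul]
  ring

lemma Ua_eq_expLoss (C0 : ℝ) (C : E → ℝ) (ca : ℝ) (σd : DefStrategy E) (τ : AttStrategy E) :
    Ua C0 C ca σd τ = C0 + expLoss C0 C (effort σd) τ - ca * (1 - τ.1 none) := by
  have h : ∀ S : Finset E, ∑ a : Option E, pureUa C0 C ca S a * τ.1 a * σd.1 S
      = (∑ a : Option E, usageCost C0 C S a * τ.1 a * σd.1 S)
        - ca * (1 - τ.1 none) * σd.1 S := by
    intro S
    have : ca * (1 - τ.1 none) * σd.1 S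
        = ∑ a : Option E, ca * (if a = none then 0 else 1) * τ.1 a * σd.1 S := by
      rw [Fintype.sum_option, ← τ.sum_some]
      simp [Finset.mul_sum, Finset.sum_mul]
    rw [this, ← Finset.sum_sub_distrib]
    exact Finset.sum_congr rfl fun a _ => by rw [pureUa]; ring
  rw [Ua, Finset.sum_congr rfl fun S _ => h S, Finset.sum_sub_distrib,
    sum_sum_usageCost, ← Finset.mul_sum, σd.2.2]
  ring

lemma Ua_eq (C0 : ℝ) (C : E → ℝ) (ca : ℝ) (σd : DefStrategy E) (τ : AttStrategy E) :
    Ua C0 C ca σd τ = C0 + ∑ a, τ.1 a * attackGain C0 C ca (effort σd) a := by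
  rw [Ua_eq_expLoss, sum_attackGain]
  ring

/-- The attacker's pure strategy `a`, as a mixed strategy. -/
noncomputable def pureAtt (a : Option E) : AttStrategy E :=
  ⟨Pi.single a 1, single_mem_stdSimplex ℝ a⟩

lemma sum_pureAtt_mul (a : Option E) (u : Option E → ℝ) :
    ∑ b, (pureAtt a).1 b * u b = u a := by
  simp [pureAtt, Pi.single_apply]

/-- The attacker's utility is linear in the mixed strategy, so pure deviations are enough. -/
lemma mem_BR_iff (C0 : ℝ) (C : E → ℝ) (ca : ℝ) (σd : DefStrategy E) (τ : AttStrategy E) :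
    τ ∈ BR C0 C ca σd ↔ ∀ a, attackGain C0 C ca (effort σd) a ≤
      ∑ b, τ.1 b * attackGain C0 C ca (effort σd) b := by
  constructor
  · intro h a
    have := h (pureAtt a)
    rwa [Ua_eq, Ua_eq, sum_pureAtt_mul, add_le_add_iff_left] at this
  · intro h τ'
    rw [Ua_eq, Ua_eq, add_le_add_iff_left]
    calc ∑ a, τ'.1 a * attackGain C0 C ca (effort σd) a
        ≤ ∑ a, τ'.1 a * ∑ b, τ.1 b * attackGain C0 C ca (effort σd) b :=
          Finset.sum_le_sum fun a _ => mul_le_mul_of_nonneg_left (h a) (τ'.2.1 a)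
      _ = _ := by rw [← Finset.sum_mul, τ'.2.2, one_mul]

lemma BR_nonempty (C0 : ℝ) (C : E → ℝ) (ca : ℝ) (σd : DefStrategy E) :
    (BR C0 C ca σd).Nonempty := by
  obtain ⟨a, -, ha⟩ := Finset.exists_max_image Finset.univ
    (attackGain C0 C ca (effort σd)) Finset.univ_nonempty
  refine ⟨pureAtt a, (mem_BR_iff ..).2 fun b => ?_⟩
  rw [sum_pureAtt_mul]
  exact ha b (Finset.mem_univ b)

/-- Against a best response, the attack threatens a usage-cost increase of at most `t`, and it
either happens surely and causes the loss `t`, or `t = ca`. -/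
lemma exists_threat_of_mem_BR {C0 : ℝ} {C : E → ℝ} {ca : ℝ} {σd : DefStrategy E}
    {τ : AttStrategy E} (h : τ ∈ BR C0 C ca σd) :
    ∃ t, (∀ e, (1 - effort σd e) * (C e - C0) ≤ t) ∧
      ((ca < t ∧ τ.1 none = 0 ∧ expLoss C0 C (effort σd) τ = t) ∨
        (t = ca ∧ expLoss C0 C (effort σd) τ = ca * (1 - τ.1 none))) := by
  rw [mem_BR_iff] at h
  set M := ∑ b, τ.1 b * attackGain C0 C ca (effort σd) b with hM
  have hL := sum_attackGain C0 C ca (effort σd) τ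
  rw [← hM] at hL
  have h0 : 0 ≤ M := h none
  refine ⟨M + ca, fun e => ?_, ?_⟩
  · have := h (some e)
    simp only [attackGain] at this
    linarith
  · rcases h0.eq_or_lt with h0 | h0
    · right
      constructor <;> linarith
    · left
      -- `M` is both the average and the maximum of the gains, so `τ` has no mass on actions of
      -- smaller gain; "no attack" is one when `M > 0`.
      have hz : ∑ b, τ.1 b * (M - attackGain C0 C ca (effort σd) b) = 0 := by
        simp_rw [mul_sub]
        rw [Finset.sum_sub_distrib, ← hM, ← Finset.sum_mul, τ.2.2]
        ring
      rw [Finset.sum_eq_zero_iff_of_nonneg fun b _ =>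
        mul_nonneg (τ.2.1 b) (sub_nonneg.2 (h b))] at hz
      have hn := hz none (Finset.mem_univ _)
      simp only [attackGain, sub_zero, mul_eq_zero, h0.ne', or_false] at hn
      rw [hn] at hL
      exact ⟨by linarith, hn, by linarith⟩

/-- Every vector of the unit cube is an effort vector: secure the facilities independently. -/
lemma exists_effort_eq (ρ : E → ℝ) (h0 : ∀ e, 0 ≤ ρ e) (h1 : ∀ e, ρ e ≤ 1) :
    ∃ σd : DefStrategy E, effort σd = ρ := by
  have key : ∀ g : E → ℝ, ∑ S : Finset E, (∏ e ∈ S, ρ e) * ∏ e ∈ Finset.univ \ S, g e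
      = ∏ e, (ρ e + g e) := by
    intro g
    rw [Finset.prod_add, Finset.powerset_univ]
  refine ⟨⟨fun S => (∏ e ∈ S, ρ e) * ∏ e ∈ Finset.univ \ S, (1 - ρ e), fun S => ?_, ?_⟩, ?_⟩
  · exact mul_nonneg (Finset.prod_nonneg fun e _ => h0 e)
      (Finset.prod_nonneg fun e _ => sub_nonneg.2 (h1 e))
  · rw [key]
    simp
  · funext e
    rw [effort_eq_sum_ite]
    -- Replacing the factor `1 - ρ e` by `0` kills exactly the sets that omit `e`, so the sum over
    -- sets containing `e` factors by `key` too.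
    have h : ∀ S : Finset E,
        (if e ∈ S then (∏ e ∈ S, ρ e) * ∏ e ∈ Finset.univ \ S, (1 - ρ e) else 0)
        = (∏ e ∈ S, ρ e) * ∏ x ∈ Finset.univ \ S, (if x = e then 0 else 1 - ρ x) := by
      intro S
      split_ifs with he
      · congr 1
        refine Finset.prod_congr rfl fun x hx => ?_
        rw [if_neg]
        rintro rfl
        simp [he] at hx
      · rw [Finset.prod_eq_zero (s := Finset.univ \ S) (i := e) (by simp [he]) (by simp), mul_zero]
    simp only [h]
    rw [key, Finset.prod_eq_single e]
    · simp
    · intro b _ hb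
      simp [hb]
    · simp

end Game

/-! ### Cheapest efforts for a given threat level -/

section Thresholds

variable {E : Type*}

/-- The least effort that reduces the expected damage of an attack on `e` to at most `t`. -/
noncomputable def minEffort (C0 : ℝ) (C : E → ℝ) (t : ℝ) (e : E) : ℝ :=
  if C0 < C e then max 0 (1 - t / (C e - C0)) else 0

/-- The least total effort that reduces the expected damage of every attack to at most `t`. -/
noncomputable def minTotal [Fintype E] (C0 : ℝ) (C : E → ℝ) (t : ℝ) : ℝ :=
  ∑ e, minEffort C0 C t e

variable {C0 : ℝ} {C : E → ℝ} {t : ℝ} {ρ : E → ℝ} {e : E}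

lemma minEffort_nonneg (t : ℝ) (e : E) : 0 ≤ minEffort C0 C t e := by
  rw [minEffort]
  split_ifs
  · exact le_max_left _ _
  · exact le_rfl

lemma minEffort_of_le (h : C e - C0 ≤ t) : minEffort C0 C t e = 0 := by
  rw [minEffort]
  split_ifs with he
  · refine max_eq_left ?_
    rw [sub_nonpos, le_div_iff₀ (sub_pos.2 he)]
    linarith
  · rfl

lemma minEffort_of_lt (ht : 0 ≤ t) (h : t < C e - C0) :
    minEffort C0 C t e = 1 - t / (C e - C0) := by
  have he : 0 < C e - C0 := ht.trans_lt h
  rw [minEffort, if_pos (sub_pos.1 he)]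
  refine max_eq_right ?_
  rw [sub_nonneg, div_le_one he]
  exact h.le

lemma minEffort_le_one (ht : 0 ≤ t) (e : E) : minEffort C0 C t e ≤ 1 := by
  rcases le_or_gt (C e - C0) t with h | h
  · rw [minEffort_of_le h]
    exact zero_le_one
  · rw [minEffort_of_lt ht h]
    have := div_nonneg ht (ht.trans h.le)
    linarith

/-- The expected damage of an attack on `e` under the effort `minEffort C0 C t`. -/
lemma one_sub_minEffort_mul (ht : 0 ≤ t) (e : E) :
    (1 - minEffort C0 C t e) * (C e - C0) = min t (C e - C0) := by
  rcases le_or_gt (C e - C0) t with h | h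
  · rw [minEffort_of_le h, min_eq_right h]
    ring
  · have : C e - C0 ≠ 0 := (ht.trans_lt h).ne'
    rw [minEffort_of_lt ht h, min_eq_left h.le]
    field_simp
    ring

lemma one_sub_minEffort_mul_le {t : ℝ} (ht : 0 ≤ t) (e : E) :
    (1 - minEffort C0 C t e) * (C e - C0) ≤ t := by
  rw [one_sub_minEffort_mul ht]
  exact min_le_left _ _

lemma minEffort_le (ht : 0 ≤ t) (h0 : 0 ≤ ρ e) (h : (1 - ρ e) * (C e - C0) ≤ t) :
    minEffort C0 C t e ≤ ρ e := by
  rcases le_or_gt (C e - C0) t with h' | h'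
  · rwa [minEffort_of_le h']
  · rw [minEffort_of_lt ht h']
    have := (le_div_iff₀ (ht.trans_lt h')).2 h
    linarith

variable [Fintype E]

lemma minTotal_le (ht : 0 ≤ t) (h0 : ∀ e, 0 ≤ ρ e)
    (h : ∀ e, (1 - ρ e) * (C e - C0) ≤ t) : minTotal C0 C t ≤ ∑ e, ρ e :=
  Finset.sum_le_sum fun e _ => minEffort_le ht (h0 e) (h e)

/-- The lower bound holds facility by facility, so equality of the totals forces equality
everywhere. -/
lemma eq_minEffort (ht : 0 ≤ t) (h0 : ∀ e, 0 ≤ ρ e)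
    (h : ∀ e, (1 - ρ e) * (C e - C0) ≤ t) (hs : ∑ e, ρ e ≤ minTotal C0 C t) :
    ρ = minEffort C0 C t := by
  have h1 := (Finset.sum_eq_sum_iff_of_le fun e (_ : e ∈ Finset.univ) =>
    minEffort_le ht (h0 e) (h e)).1 ((minTotal_le ht h0 h).antisymm hs)
  exact funext fun e => (h1 e (Finset.mem_univ e)).symm

lemma continuous_minTotal : Continuous (minTotal C0 C) := by
  unfold minTotal
  refine continuous_finsetSum _ fun e _ => ?_
  unfold minEffort
  split_ifs
  · fun_prop
  · exact continuous_const

lemma minTotal_anti {s t : ℝ} (hs : 0 ≤ s) (h : s ≤ t) :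
    minTotal C0 C t ≤ minTotal C0 C s :=
  minTotal_le (hs.trans h) (minEffort_nonneg s) fun e => by
    rw [one_sub_minEffort_mul hs]
    exact (min_le_left _ _).trans h

lemma minTotal_strictAnti {s t : ℝ} (hs : 0 ≤ s) (h : s < t) (he : s < C e - C0) :
    minTotal C0 C t < minTotal C0 C s := by
  refine lt_of_le_of_ne (minTotal_anti hs h.le) fun heq => ?_
  -- Equal totals would give equal efforts, yet the expected damage at `e` is `s` under one vector
  -- and `min t (C e - C0) > s` under the other.
  have h1 : minEffort C0 C s = minEffort C0 C t := by
    refine eq_minEffort (hs.trans h.le) (minEffort_nonneg s) (fun e => ?_) heq.ge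
    rw [one_sub_minEffort_mul hs]
    exact (min_le_left _ _).trans h.le
  have h2 := one_sub_minEffort_mul (C0 := C0) (C := C) hs e
  rw [h1, one_sub_minEffort_mul (hs.trans h.le), min_eq_left he.le] at h2
  exact (lt_min h he).ne' h2

/-- Under the efforts `minEffort C0 C d`, the attacker targets the facilities of damage at
least `d`. -/
lemma expLoss_minEffort_eq_iff {d : ℝ} (hd : 0 < d) (τ : AttStrategy E) :
    expLoss C0 C (minEffort C0 C d) τ = d ↔
      AttacksWithin τ (Finset.univ.filter fun e => d ≤ C e - C0) := by
  have hid : d - expLoss C0 C (minEffort C0 C d) τ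
      = d * τ.1 none + ∑ e, τ.1 (some e) * (d - min d (C e - C0)) := by
    simp_rw [expLoss, one_sub_minEffort_mul hd.le, mul_sub, Finset.sum_sub_distrib,
      ← Finset.sum_mul, τ.sum_some]
    ring
  have h1 : 0 ≤ d * τ.1 none := mul_nonneg hd.le (τ.2.1 _)
  have h2 : ∀ e ∈ Finset.univ, 0 ≤ τ.1 (some e) * (d - min d (C e - C0)) := fun e _ =>
    mul_nonneg (τ.2.1 _) (sub_nonneg.2 (min_le_left _ _))
  rw [eq_comm, ← sub_eq_zero, hid, add_eq_zero_iff_of_nonneg h1 (Finset.sum_nonneg h2),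
    Finset.sum_eq_zero_iff_of_nonneg h2, AttacksWithin]
  refine and_congr (by simp [hd.ne']) (forall_congr' fun e => ?_)
  simp only [Finset.mem_univ, true_imp_iff, Finset.mem_filter, true_and, not_le, mul_eq_zero]
  constructor
  · intro h hlt
    refine h.resolve_right ?_
    rw [min_eq_right hlt.le]
    exact (sub_pos.2 hlt).ne'
  · intro h
    by_cases hlt : C e - C0 < d
    · exact Or.inl (h hlt)
    · right
      rw [min_eq_left (not_lt.1 hlt), sub_self]

/-! ### Dual certificates for the optimal threshold -/

/-- The total inverse damage of the facilities of damage at least `d`. -/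
noncomputable def invAbove (C0 : ℝ) (C : E → ℝ) (d : ℝ) : ℝ :=
  ∑ e with d ≤ C e - C0, (C e - C0)⁻¹

/-- The total inverse damage of the facilities of damage greater than `d`. -/
noncomputable def invStrictAbove (C0 : ℝ) (C : E → ℝ) (d : ℝ) : ℝ :=
  ∑ e with d < C e - C0, (C e - C0)⁻¹

/-- Attack probabilities that certify the optimality of the threshold `d` for the
defense cost `c`. -/
structure IsCertificate (C0 : ℝ) (C : E → ℝ) (c d : ℝ) (w : E → ℝ) : Prop where
  nonneg : ∀ e, 0 ≤ w e
  sum_eq : ∑ e, w e = 1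
  of_gt : ∀ e, d < C e - C0 → w e * (C e - C0) = c
  le : ∀ e, w e * (C e - C0) ≤ c
  eq : ∀ e, w e * (C e - C0) = c * minEffort C0 C d e + d * w e
  of_lt : ∀ e, C e - C0 < d → w e = 0

lemma invAbove_eq {d : ℝ} :
    invAbove C0 C d = invStrictAbove C0 C d
      + ((Finset.univ.filter fun e => C e - C0 = d).card : ℝ) * d⁻¹ := by
  rw [invAbove, invStrictAbove, Finset.sum_filter, Finset.sum_filter, Finset.card_filter]
  push_cast
  rw [Finset.sum_mul, ← Finset.sum_add_distrib]
  refine Finset.sum_congr rfl fun e _ => ?_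
  rcases lt_trichotomy d (C e - C0) with h | h | h
  · simp [h, h.le, h.ne']
  · simp [← h]
  · simp [h.not_ge, h.not_gt, h.ne]

/-- A facility of damage above `d` gets probability `c / (C e - C0)`, which makes securing it
exactly break even, and one below `d` gets none. The remaining mass is spread evenly over the
facilities of damage `d`: `hlo` makes it nonnegative, and `hhi` keeps these facilities not worth
securing. Strictness in either bound yields the strict complementarity that uniqueness needs. -/
lemma exists_isCertificate {c d : ℝ} (hd : 0 < d) (hc : 0 < c) (hex : ∃ e, C e - C0 = d)
    (hlo : c * invStrictAbove C0 C d ≤ 1) (hhi : 1 ≤ c * invAbove C0 C d) :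
    ∃ w, IsCertificate C0 C c d w ∧
      (c * invStrictAbove C0 C d < 1 → ∀ e, d ≤ C e - C0 → 0 < w e) ∧
      (1 < c * invAbove C0 C d → ∀ e, C e - C0 ≤ d → w e * (C e - C0) < c) := by
  set n : ℝ := ((Finset.univ.filter fun e => C e - C0 = d).card : ℝ) with hn
  have hn0 : 0 < n := by
    obtain ⟨e, he⟩ := hex
    rw [hn, Nat.cast_pos, Finset.card_pos]
    exact ⟨e, by simpa using he⟩
  -- The share of the leftover mass given to each of the `n` facilities of damage exactly `d`.
  set v : ℝ := (1 - c * invStrictAbove C0 C d) / n with hv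
  have hv0 : 0 ≤ v := div_nonneg (sub_nonneg.2 hlo) hn0.le
  have hvd : v * d ≤ c ∧ (1 < c * invAbove C0 C d → v * d < c) := by
    have h1 : c * invAbove C0 C d = c * invStrictAbove C0 C d + c * n * d⁻¹ := by
      rw [invAbove_eq, ← hn]
      ring
    have h2 : v * d = c - (c * invAbove C0 C d - 1) * d / n := by
      rw [h1, hv]
      field_simp
      ring
    constructor
    · have := div_nonneg (mul_nonneg (sub_nonneg.2 hhi) hd.le) hn0.le
      linarith
    · intro h
      have := div_pos (mul_pos (sub_pos.2 h) hd) hn0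
      linarith
  have gt_ne : ∀ e, d < C e - C0 → C e - C0 ≠ 0 := fun e he => (hd.trans he).ne'
  refine ⟨fun e => if d < C e - C0 then c / (C e - C0) else if C e - C0 = d then v else 0,
    ⟨fun e => ?_, ?_, fun e he => ?_, fun e => ?_, fun e => ?_, fun e he => ?_⟩,
    fun h e he => ?_, fun h e he => ?_⟩
  · split_ifs with h1 h2
    · exact div_nonneg hc.le (hd.trans h1).le
    · exact hv0
    · exact le_rfl
  · have h : ∀ e : E, (if d < C e - C0 then c / (C e - C0) else if C e - C0 = d then v else 0)
        = c * (if d < C e - C0 then (C e - C0)⁻¹ else 0)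
          + v * (if C e - C0 = d then 1 else 0) := by
      intro e
      split_ifs with h1 h2 h2
      · exact absurd h2 h1.ne'
      · ring
      · ring
      · ring
    simp_rw [h]
    rw [Finset.sum_add_distrib, ← Finset.mul_sum, ← Finset.mul_sum, ← Finset.sum_filter,
      Finset.sum_boole, ← hn, hv, ← invStrictAbove]
    field_simp
    ring
  · rw [if_pos he, div_mul_cancel₀ _ (gt_ne e he)]
  · split_ifs with h1 h2
    · rw [div_mul_cancel₀ _ (gt_ne e h1)]
    · rw [h2]
      exact hvd.1
    · simpa using hc.le
  · split_ifs with h1 h2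
    · have := gt_ne e h1
      rw [minEffort_of_lt hd.le h1]
      field_simp
      ring
    · rw [minEffort_of_le h2.le, h2]
      ring
    · rw [minEffort_of_le (not_lt.1 h1)]
      ring
  · rw [if_neg he.not_gt, if_neg he.ne]
  · dsimp only
    split_ifs with h1 h2
    · exact div_pos hc (hd.trans h1)
    · exact div_pos (sub_pos.2 h) hn0
    · exact absurd (he.lt_of_ne' h2) h1
  · dsimp only
    rw [if_neg he.not_gt]
    split_ifs with h2
    · rw [h2]
      exact hvd.2 h
    · simpa using hc

namespace IsCertificate

variable {c d : ℝ} {w : E → ℝ}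

lemma sum_mul (hw : IsCertificate C0 C c d w) :
    ∑ e, w e * (C e - C0) = d + c * minTotal C0 C d := by
  rw [Finset.sum_congr rfl fun e _ => hw.eq e, Finset.sum_add_distrib, ← Finset.mul_sum,
    ← Finset.mul_sum, hw.sum_eq, minTotal]
  ring

/-- The duality gap of `(t, ρ)` as a sum of complementary slackness terms: the first pairs `w e`
with the threat constraint at `e`, the second pairs `ρ e` with the break-even constraint. -/
lemma sum_slack (hw : IsCertificate C0 C c d w) (t : ℝ) (ρ : E → ℝ) :
    ∑ e, (w e * (t - (1 - ρ e) * (C e - C0)) + ρ e * (c - w e * (C e - C0)))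
      = (t + c * ∑ e, ρ e) - (d + c * minTotal C0 C d) := by
  rw [← hw.sum_mul, Finset.mul_sum]
  have : t = ∑ e, w e * t := by rw [← Finset.sum_mul, hw.sum_eq, one_mul]
  rw [this, ← Finset.sum_add_distrib, ← Finset.sum_sub_distrib, ← this]
  exact Finset.sum_congr rfl fun e _ => by ring

lemma slack_nonneg (hw : IsCertificate C0 C c d w) (h0 : ∀ e, 0 ≤ ρ e)
    (h : ∀ e, (1 - ρ e) * (C e - C0) ≤ t) (e : E) :
    0 ≤ w e * (t - (1 - ρ e) * (C e - C0)) ∧ 0 ≤ ρ e * (c - w e * (C e - C0)) :=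
  ⟨mul_nonneg (hw.nonneg e) (sub_nonneg.2 (h e)),
    mul_nonneg (h0 e) (sub_nonneg.2 (hw.le e))⟩

/-- The threshold `d` is optimal. -/
lemma le_add_sum (hw : IsCertificate C0 C c d w) (h0 : ∀ e, 0 ≤ ρ e)
    (h : ∀ e, (1 - ρ e) * (C e - C0) ≤ t) :
    d + c * minTotal C0 C d ≤ t + c * ∑ e, ρ e := by
  rw [← sub_nonneg, ← hw.sum_slack]
  exact Finset.sum_nonneg fun e _ =>
    add_nonneg (hw.slack_nonneg h0 h e).1 (hw.slack_nonneg h0 h e).2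

lemma le_add_minTotal (hw : IsCertificate C0 C c d w)
    (ht : 0 ≤ t) : d + c * minTotal C0 C d ≤ t + c * minTotal C0 C t :=
  hw.le_add_sum (minEffort_nonneg t) (one_sub_minEffort_mul_le ht)

/-- The threshold `d` and the efforts `minEffort C0 C d` are the only optimal ones. -/
lemma eq_of_add_sum_le (hw : IsCertificate C0 C c d w) (hd : 0 < d) (hex : ∃ e, C e - C0 = d)
    (hpos : ∀ e, d ≤ C e - C0 → 0 < w e) (hlt : ∀ e, C e - C0 ≤ d → w e * (C e - C0) < c)
    (h0 : ∀ e, 0 ≤ ρ e) (h : ∀ e, (1 - ρ e) * (C e - C0) ≤ t)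
    (hle : t + c * ∑ e, ρ e ≤ d + c * minTotal C0 C d) :
    t = d ∧ ρ = minEffort C0 C d := by
  have hz := hw.sum_slack t ρ
  rw [sub_eq_zero.2 (hle.antisymm (hw.le_add_sum h0 h)),
    Finset.sum_eq_zero_iff_of_nonneg fun e _ =>
      add_nonneg (hw.slack_nonneg h0 h e).1 (hw.slack_nonneg h0 h e).2] at hz
  have hz1 : ∀ e, w e * (t - (1 - ρ e) * (C e - C0)) = 0 := fun e => by
    have h1 := hz e (Finset.mem_univ e)
    have h2 := hw.slack_nonneg h0 h e
    linarith
  have hz2 : ∀ e, ρ e * (c - w e * (C e - C0)) = 0 := fun e => by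
    have h1 := hz e (Finset.mem_univ e)
    have h2 := hw.slack_nonneg h0 h e
    linarith
  -- Securing such a facility costs strictly more than it saves. A facility of damage exactly `d` is
  -- therefore unsecured, and its tight threat constraint pins down `t`.
  have hlow : ∀ e, C e - C0 ≤ d → ρ e = 0 := fun e he =>
    (mul_eq_zero.1 (hz2 e)).resolve_right (sub_pos.2 (hlt e he)).ne'
  have ht : t = d := by
    obtain ⟨e, he⟩ := hex
    have h1 := (mul_eq_zero.1 (hz1 e)).resolve_left (hpos e he.ge).ne'
    rw [hlow e he.le, he] at h1
    linarith
  subst ht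
  refine ⟨rfl, funext fun e => ?_⟩
  rcases le_or_gt (C e - C0) t with he | he
  · rw [hlow e he, minEffort_of_le he]
  · have h1 := (mul_eq_zero.1 (hz1 e)).resolve_left (hpos e he.le).ne'
    have h2 : C e - C0 ≠ 0 := (hd.trans he).ne'
    rw [minEffort_of_lt hd.le he]
    field_simp
    linarith

end IsCertificate

end Thresholds

/-! ### From optimal thresholds to equilibria -/

section Equilibria

variable {E : Type*} [Fintype E] [DecidableEq E] {C0 : ℝ} {C : E → ℝ} {ca cd d : ℝ}
  {σd : DefStrategy E}

lemma exists_effort_eq_minEffort (C0 : ℝ) (C : E → ℝ) {t : ℝ} (ht : 0 ≤ t) :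
    ∃ σd : DefStrategy E, effort σd = minEffort C0 C t :=
  exists_effort_eq _ (minEffort_nonneg t) (minEffort_le_one ht)

/-- Best responses exist, so any prescribed reply to one defense extends off the equilibrium path.
-/
lemma exists_forall_mem_BR (C0 : ℝ) (C : E → ℝ) (ca : ℝ) (σd : DefStrategy E)
    (τ : AttStrategy E) :
    ∃ σa : DefStrategy E → AttStrategy E, σa σd = τ ∧
      ∀ σd', σd' ≠ σd → σa σd' ∈ BR C0 C ca σd' := by
  classical
  refine ⟨fun σ => if σ = σd then τ else (BR_nonempty C0 C ca σ).some, if_pos rfl,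
    fun σd' h => ?_⟩
  simp only [if_neg h]
  exact (BR_nonempty C0 C ca σd').some_mem

lemma isSPE_iff_mem_BR (σa : DefStrategy E → AttStrategy E) :
    IsSPE C0 C ca cd σd σa ↔ (∀ σd', σa σd' ∈ BR C0 C ca σd') ∧
      ∀ σd', expLoss C0 C (effort σd) (σa σd) + cd * ∑ e, effort σd e
        ≤ expLoss C0 C (effort σd') (σa σd') + cd * ∑ e, effort σd' e := by
  simp only [IsSPE, Ud_eq, BR, Set.mem_ofPred_eq]
  rw [and_comm]
  refine and_congr Iff.rfl (forall_congr' fun σd' => ?_)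
  constructor <;> intro h <;> linarith

/-! ### Deterring the attack -/

/-- Efforts slightly above `minEffort C0 C ca` deter the attack. -/
lemma expLoss_eq_zero_of_lt {t : ℝ} {τ : AttStrategy E} (hτ : τ ∈ BR C0 C ca σd)
    (hta : t < ca) (ht : ∀ e, (1 - effort σd e) * (C e - C0) ≤ t) :
    τ.1 none = 1 ∧ expLoss C0 C (effort σd) τ = 0 := by
  have hL := expLoss_le ht τ
  have h1 := τ.none_le_one
  have hn : τ.1 none = 1 := by
    obtain ⟨s, -, ⟨hs, hn, hLs⟩ | ⟨-, hLs⟩⟩ := exists_threat_of_mem_BR hτ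
    · rw [hn] at hL
      linarith
    · rw [hLs] at hL
      have h2 : (ca - t) * (1 - τ.1 none) ≤ 0 := by linarith
      have h3 := nonpos_of_mul_nonpos_right h2 (sub_pos.2 hta)
      linarith
  exact ⟨hn, expLoss_eq_zero hn⟩

/-- The efforts `minEffort C0 C ca` themselves leave the attacker indifferent, so nothing guarantees
the value `cd * minTotal C0 C ca` there. Each threshold `t < ca` does guarantee `cd * minTotal C0 C
t`; let `t` increase to `ca`. -/
lemma IsSPE.le_of_deterrence {σa : DefStrategy E → AttStrategy E} (hca : 0 < ca)
    (h : IsSPE C0 C ca cd σd σa) :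
    expLoss C0 C (effort σd) (σa σd) + cd * ∑ e, effort σd e ≤ cd * minTotal C0 C ca := by
  rw [isSPE_iff_mem_BR] at h
  have hlim : Filter.Tendsto (fun t => cd * minTotal C0 C t) (nhdsWithin ca (Set.Iio ca))
      (nhds (cd * minTotal C0 C ca)) :=
    ((continuous_const.mul continuous_minTotal).tendsto ca).mono_left nhdsWithin_le_nhds
  refine ge_of_tendsto hlim ?_
  filter_upwards [Ioo_mem_nhdsLT hca] with t ht
  obtain ⟨σd', hσ⟩ := exists_effort_eq_minEffort C0 C ht.1.le
  have h1 := h.2 σd'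
  rw [(expLoss_eq_zero_of_lt (h.1 σd') ht.2 fun e => by
    rw [hσ]; exact one_sub_minEffort_mul_le ht.1.le e).2, hσ, zero_add] at h1
  exact h1

/-- No-attack is a best response to the efforts `minEffort C0 C ca`. -/
lemma mem_BR_of_effort_eq (hca : 0 < ca) (hσ : effort σd = minEffort C0 C ca)
    {τ : AttStrategy E} (hτ : τ.1 none = 1) : τ ∈ BR C0 C ca σd := by
  rw [mem_BR_iff, sum_attackGain, expLoss_eq_zero hτ, hτ]
  rintro (_ | e)
  · simp [attackGain]
  · have := min_le_left ca (C e - C0)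
    rw [← one_sub_minEffort_mul hca.le, ← hσ] at this
    simp only [attackGain]
    linarith

/-- The equilibria when deterring the attack is cheaper than tolerating it. -/
theorem isSPE_iff_of_deterrence (hca : 0 < ca) (hcd : 0 < cd)
    (H : ∀ (ρ : E → ℝ) (t : ℝ), (∀ e, 0 ≤ ρ e) → (∀ e, (1 - ρ e) * (C e - C0) ≤ t) → ca < t →
      cd * minTotal C0 C ca < t + cd * ∑ e, ρ e)
    (σd : DefStrategy E) (σa : DefStrategy E → AttStrategy E) :
    IsSPE C0 C ca cd σd σa ↔ effort σd = minEffort C0 C ca ∧ (σa σd).1 none = 1 ∧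
      ∀ σd', σd' ≠ σd → σa σd' ∈ BR C0 C ca σd' := by
  constructor
  · intro h
    have hle := h.le_of_deterrence hca
    rw [isSPE_iff_mem_BR] at h
    obtain ⟨t, ht, ⟨hat, -, hL⟩ | ⟨rfl, hL⟩⟩ := exists_threat_of_mem_BR (h.1 σd)
    · rw [hL] at hle
      exact absurd hle (H _ t (effort_nonneg σd) ht hat).not_ge
    · have h1 := mul_le_mul_of_nonneg_left (minTotal_le hca.le (effort_nonneg σd) ht) hcd.le
      have h2 := (σa σd).none_le_one
      have h3 : 0 ≤ t * (1 - (σa σd).1 none) := mul_nonneg hca.le (sub_nonneg.2 h2)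
      rw [hL] at hle
      refine ⟨eq_minEffort hca.le (effort_nonneg σd) ht ?_, ?_, fun σd' _ => h.1 σd'⟩
      · exact le_of_mul_le_mul_left (by linarith) hcd
      · have h4 : t * (1 - (σa σd).1 none) = 0 := by linarith
        have := (mul_eq_zero.1 h4).resolve_left hca.ne'
        linarith
  · rintro ⟨hσ, hn, hBR⟩
    rw [isSPE_iff_mem_BR]
    have hB : ∀ σd', σa σd' ∈ BR C0 C ca σd' := by
      intro σd'
      by_cases hs : σd' = σd
      · rw [hs]
        exact mem_BR_of_effort_eq hca hσ hn
      · exact hBR σd' hs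
    refine ⟨hB, fun σd' => ?_⟩
    rw [expLoss_eq_zero hn, hσ, zero_add, ← minTotal]
    obtain ⟨t, ht, ⟨hat, -, hL⟩ | ⟨rfl, hL⟩⟩ := exists_threat_of_mem_BR (hB σd')
    · rw [hL]
      exact (H _ t (effort_nonneg σd') ht hat).le
    · have h1 := mul_le_mul_of_nonneg_left (minTotal_le hca.le (effort_nonneg σd') ht) hcd.le
      have h3 : 0 ≤ t * (1 - (σa σd').1 none) :=
        mul_nonneg hca.le (sub_nonneg.2 (σa σd').none_le_one)
      linarith

/-- The condition `P` concerns only the reply on the path, so one strategy with efforts `ρ₀` and one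
reply satisfying `P` give existence. -/
lemma speEfforts_eq_singleton {ρ₀ : E → ℝ} {P : AttStrategy E → Prop}
    (hρ : ∃ σd : DefStrategy E, effort σd = ρ₀) (hP : ∃ τ, P τ)
    (h : ∀ (σd : DefStrategy E) (σa : DefStrategy E → AttStrategy E),
      IsSPE C0 C ca cd σd σa ↔ effort σd = ρ₀ ∧ P (σa σd) ∧
        ∀ σd', σd' ≠ σd → σa σd' ∈ BR C0 C ca σd') :
    speEfforts C0 C ca cd = {ρ₀} := by
  ext ρ
  rw [Set.mem_singleton_iff]
  constructor
  · rintro ⟨σd, σa, hs, rfl⟩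
    exact ((h σd σa).1 hs).1
  · rintro rfl
    obtain ⟨σd, hσ⟩ := hρ
    obtain ⟨τ, hτ⟩ := hP
    obtain ⟨σa, rfl, hB⟩ := exists_forall_mem_BR C0 C ca σd τ
    exact ⟨σd, σa, (h σd σa).2 ⟨hσ, hτ, hB⟩, hσ⟩

lemma existsUnique_mem_of_eq_singleton {α : Type*} {s : Set α} {a : α} (h : s = {a}) :
    ∃! x, x ∈ s := by
  rw [h]
  exact ⟨a, rfl, fun _ hx => hx⟩

lemma speEfforts_of_deterrence (hca : 0 < ca) (hcd : 0 < cd)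
    (H : ∀ (ρ : E → ℝ) (t : ℝ), (∀ e, 0 ≤ ρ e) → (∀ e, (1 - ρ e) * (C e - C0) ≤ t) → ca < t →
      cd * minTotal C0 C ca < t + cd * ∑ e, ρ e) :
    speEfforts C0 C ca cd = {minEffort C0 C ca} :=
  speEfforts_eq_singleton (P := fun τ => τ.1 none = 1) (exists_effort_eq_minEffort C0 C hca.le)
    ⟨pureAtt none, by simp [pureAtt]⟩ (isSPE_iff_of_deterrence hca hcd H)

/-! ### Tolerating the attack -/

/-- Under these efforts an attack on `e` has expected damage `min d (C e - C0)`. Its maximum `d` is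
attained by `hex` and exceeds `ca`, so best responses are the attacks with expected loss `d`. -/
lemma mem_BR_iff_attacksWithin (hca : 0 < ca) (had : ca < d) (hex : ∃ e, C e - C0 = d)
    (hσ : effort σd = minEffort C0 C d) (τ : AttStrategy E) :
    τ ∈ BR C0 C ca σd ↔ AttacksWithin τ (Finset.univ.filter fun e => d ≤ C e - C0) := by
  have hd := hca.trans had
  have hmin : ∀ e, (1 - effort σd e) * (C e - C0) ≤ d := fun e => by
    rw [hσ, one_sub_minEffort_mul hd.le]
    exact min_le_left _ _
  rw [← expLoss_minEffort_eq_iff hd, ← hσ]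
  constructor
  · intro h
    obtain ⟨e, he⟩ := hex
    obtain ⟨t, ht, ⟨hat, hn, hL⟩ | ⟨rfl, -⟩⟩ := exists_threat_of_mem_BR h
    · have h1 := ht e
      rw [hσ, one_sub_minEffort_mul hd.le, he, min_self] at h1
      have h2 := expLoss_le hmin τ
      rw [hn, sub_zero, mul_one] at h2
      linarith
    · have h1 := ht e
      rw [hσ, one_sub_minEffort_mul hd.le, he, min_self] at h1
      linarith
  · intro h
    have hn : τ.1 none = 0 := by
      rw [hσ, expLoss_minEffort_eq_iff hd] at h
      exact h.1
    rw [mem_BR_iff, sum_attackGain, h, hn]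
    rintro (_ | e)
    · simp only [attackGain]
      linarith
    · have := hmin e
      simp only [attackGain]
      linarith

/-- The equilibria when it is optimal to tolerate attacks that increase the usage cost by `d`. -/
theorem isSPE_iff_of_tolerance (hca : 0 < ca) (hcd : 0 < cd) (had : ca < d)
    (hex : ∃ e, C e - C0 = d)
    (H₁ : d + cd * minTotal C0 C d < cd * minTotal C0 C ca)
    (H₂ : ∀ (ρ : E → ℝ) (t : ℝ), (∀ e, 0 ≤ ρ e) → (∀ e, (1 - ρ e) * (C e - C0) ≤ t) →
      d + cd * minTotal C0 C d ≤ t + cd * ∑ e, ρ e)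
    (H₃ : ∀ (ρ : E → ℝ) (t : ℝ), (∀ e, 0 ≤ ρ e) → (∀ e, (1 - ρ e) * (C e - C0) ≤ t) →
      t + cd * ∑ e, ρ e ≤ d + cd * minTotal C0 C d → t = d ∧ ρ = minEffort C0 C d)
    (σd : DefStrategy E) (σa : DefStrategy E → AttStrategy E) :
    IsSPE C0 C ca cd σd σa ↔ effort σd = minEffort C0 C d ∧
      AttacksWithin (σa σd) (Finset.univ.filter fun e => d ≤ C e - C0) ∧
      ∀ σd', σd' ≠ σd → σa σd' ∈ BR C0 C ca σd' := by
  have hd := hca.trans had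
  have hval : ∀ {σ : DefStrategy E}, effort σ = minEffort C0 C d → σa σ ∈ BR C0 C ca σ →
      expLoss C0 C (effort σ) (σa σ) + cd * ∑ e, effort σ e = d + cd * minTotal C0 C d := by
    intro σ hσ h
    have h1 := (mem_BR_iff_attacksWithin hca had hex hσ _).1 h
    rw [← expLoss_minEffort_eq_iff hd] at h1
    rw [hσ, h1, minTotal]
  constructor
  · intro h
    rw [isSPE_iff_mem_BR] at h
    obtain ⟨σd', hσ'⟩ := exists_effort_eq_minEffort C0 C hd.le
    have hle := (h.2 σd').trans_eq (hval hσ' (h.1 σd'))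
    have hσ : effort σd = minEffort C0 C d := by
      obtain ⟨t, ht, ⟨hat, -, hL⟩ | ⟨rfl, hL⟩⟩ := exists_threat_of_mem_BR (h.1 σd)
      · rw [hL] at hle
        exact (H₃ _ t (effort_nonneg σd) ht hle).2
      · have h1 := mul_le_mul_of_nonneg_left (minTotal_le hca.le (effort_nonneg σd) ht) hcd.le
        have h3 : 0 ≤ t * (1 - (σa σd).1 none) :=
          mul_nonneg hca.le (sub_nonneg.2 (σa σd).none_le_one)
        rw [hL] at hle
        linarith
    exact ⟨hσ, (mem_BR_iff_attacksWithin hca had hex hσ _).1 (h.1 σd), fun σd' _ => h.1 σd'⟩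
  · rintro ⟨hσ, hA, hBR⟩
    rw [isSPE_iff_mem_BR]
    have hB : ∀ σd', σa σd' ∈ BR C0 C ca σd' := by
      intro σd'
      by_cases hs : σd' = σd
      · rw [hs]
        exact (mem_BR_iff_attacksWithin hca had hex hσ _).2 hA
      · exact hBR σd' hs
    refine ⟨hB, fun σd' => ?_⟩
    rw [hval hσ (hB σd)]
    obtain ⟨t, ht, ⟨hat, -, hL⟩ | ⟨rfl, hL⟩⟩ := exists_threat_of_mem_BR (hB σd')
    · rw [hL]
      exact H₂ _ t (effort_nonneg σd') ht
    · have h1 := mul_le_mul_of_nonneg_left (minTotal_le hca.le (effort_nonneg σd') ht) hcd.le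
      have h3 : 0 ≤ t * (1 - (σa σd').1 none) :=
        mul_nonneg hca.le (sub_nonneg.2 (σa σd').none_le_one)
      linarith

/-! ### Nash equilibria of the simultaneous-move game -/

/-- The attack probabilities of a certificate, as a strategy of the attacker. -/
noncomputable def IsCertificate.attStrategy {c : ℝ} {w : E → ℝ}
    (hw : IsCertificate C0 C c d w) : AttStrategy E :=
  ⟨fun a => a.elim 0 w, fun a => by cases a with
    | none => exact le_rfl
    | some e => exact hw.nonneg e, by
    rw [Fintype.sum_option]
    simpa using hw.sum_eq⟩

/-- A strategy of the defender of efforts `minEffort C0 C d` and the attack probabilities of a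
certificate form a Nash equilibrium. -/
lemma IsCertificate.isNE {w : E → ℝ} (hw : IsCertificate C0 C cd d w) (hca : 0 < ca)
    (had : ca < d) (hex : ∃ e, C e - C0 = d) (hσ : effort σd = minEffort C0 C d) :
    IsNE C0 C ca cd σd hw.attStrategy := by
  have hd := hca.trans had
  have hA : AttacksWithin hw.attStrategy (Finset.univ.filter fun e => d ≤ C e - C0) := by
    refine ⟨rfl, fun e he => ?_⟩
    simp only [Finset.mem_filter, Finset.mem_univ, true_and, not_le] at he
    exact hw.of_lt e he
  refine ⟨fun σd' => ?_, (mem_BR_iff_attacksWithin hca had hex hσ _).2 hA⟩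
  have hval : expLoss C0 C (effort σd) hw.attStrategy = d := by
    rw [hσ, expLoss_minEffort_eq_iff hd]
    exact hA
  -- Against `w`, a deviation changes the defender's cost by these break-even slacks, which are
  -- nonnegative.
  have h1 : ∑ e, effort σd' e * (cd - w e * (C e - C0))
      = expLoss C0 C (effort σd') hw.attStrategy + cd * ∑ e, effort σd' e
        - (d + cd * minTotal C0 C d) := by
    rw [← hw.sum_mul, expLoss, Finset.mul_sum, ← Finset.sum_add_distrib,
      ← Finset.sum_sub_distrib]
    refine Finset.sum_congr rfl fun e _ => ?_
    simp only [IsCertificate.attStrategy, Option.elim]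
    ring
  have h2 : 0 ≤ ∑ e, effort σd' e * (cd - w e * (C e - C0)) :=
    Finset.sum_nonneg fun e _ =>
      mul_nonneg (effort_nonneg σd' e) (sub_nonneg.2 (hw.le e))
  rw [Ud_eq, Ud_eq, hval, hσ, ← minTotal]
  linarith

/-- Up to terms that the opponent controls, the game is zero-sum, so the efforts in Nash
equilibria minimize the worst-case loss. -/
lemma effort_eq_of_isNE {w : E → ℝ} (hw : IsCertificate C0 C cd d w) (hca : 0 < ca)
    (had : ca < d) (hex : ∃ e, C e - C0 = d)
    (H₁ : d + cd * minTotal C0 C d < cd * minTotal C0 C ca) (hcd : 0 < cd)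
    (H₃ : ∀ (ρ : E → ℝ) (t : ℝ), (∀ e, 0 ≤ ρ e) → (∀ e, (1 - ρ e) * (C e - C0) ≤ t) →
      t + cd * ∑ e, ρ e ≤ d + cd * minTotal C0 C d → t = d ∧ ρ = minEffort C0 C d)
    {τ : AttStrategy E} (h : IsNE C0 C ca cd σd τ) : effort σd = minEffort C0 C d := by
  have hd := hca.trans had
  -- Comparison with the equilibrium `(σs, w)`: `σd` is optimal against `τ`, and `w` against `σs`.
  -- Adding the two inequalities bounds the cost at `(σd, τ)` by `d + cd * minTotal C0 C d - ca *
  -- τ.1 none`. If the threat is `ca`, this contradicts `H₁`; otherwise `H₃` applies.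
  obtain ⟨σs, hσs⟩ := exists_effort_eq_minEffort C0 C hd.le
  have hNE := hw.isNE hca had hex hσs
  have hdef := h.1 σs
  have hatt := hNE.2 τ
  have hA := (mem_BR_iff_attacksWithin hca had hex hσs _).1 hNE.2
  have hn : hw.attStrategy.1 none = 0 := rfl
  rw [← expLoss_minEffort_eq_iff hd, ← hσs] at hA
  rw [Ua_eq_expLoss, Ua_eq_expLoss, hA, hn] at hatt
  have hsum : ∑ e, effort σs e = minTotal C0 C d := by rw [hσs, minTotal]
  rw [Ud_eq, Ud_eq, hsum] at hdef
  obtain ⟨t, ht, ⟨hat, hτ, hL⟩ | ⟨rfl, hL⟩⟩ := exists_threat_of_mem_BR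
    (show τ ∈ BR C0 C ca σd from h.2)
  · rw [hτ] at hatt
    exact (H₃ _ t (effort_nonneg σd) ht (by linarith)).2
  · have h1 := mul_le_mul_of_nonneg_left (minTotal_le hca.le (effort_nonneg σd) ht) hcd.le
    linarith

end Equilibria

/-! ### Ordered cost groups and the piecewise threshold -/

section Ordering

variable {E : Type*} [Fintype E] (C0 : ℝ) (C : E → ℝ)

lemma length_sort_costValues :
    ((costValues C0 C).sort (· ≥ ·)).length = numValues C0 C :=
  Finset.length_sort _

variable {C0 C}

lemma ordCost_eq_getElem {k : ℕ} (h : k - 1 < ((costValues C0 C).sort (· ≥ ·)).length) :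
    ordCost C0 C k = ((costValues C0 C).sort (· ≥ ·))[k - 1] := by
  rw [ordCost, List.getD_eq_getElem]

lemma ordCost_of_gt {k : ℕ} (h : numValues C0 C < k) : ordCost C0 C k = C0 := by
  rw [ordCost, List.getD_eq_default]
  rw [length_sort_costValues]
  omega

lemma ordCost_mem {k : ℕ} (h1 : 1 ≤ k) (hk : k ≤ numValues C0 C) :
    ordCost C0 C k ∈ costValues C0 C := by
  have h : k - 1 < ((costValues C0 C).sort (· ≥ ·)).length := by
    rw [length_sort_costValues]
    omega
  rw [ordCost_eq_getElem h, ← Finset.mem_sort (· ≥ ·)]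
  exact List.getElem_mem h

lemma exists_eq_ordCost {k : ℕ} (h1 : 1 ≤ k) (hk : k ≤ numValues C0 C) :
    ∃ e, C0 < C e ∧ C e = ordCost C0 C k := by
  have h := ordCost_mem h1 hk
  simpa [costValues, Ebar] using h

lemma exists_sub_eq {j : ℕ} (h1 : 1 ≤ j) (hj : j ≤ numValues C0 C) :
    ∃ e, C e - C0 = ordCost C0 C j - C0 := by
  obtain ⟨e, -, he⟩ := exists_eq_ordCost h1 hj
  exact ⟨e, by rw [he]⟩

lemma lt_ordCost {k : ℕ} (h1 : 1 ≤ k) (hk : k ≤ numValues C0 C) : C0 < ordCost C0 C k := by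
  obtain ⟨e, he, heq⟩ := exists_eq_ordCost h1 hk
  rwa [← heq]

lemma ordCost_lt {a b : ℕ} (ha : 1 ≤ a) (hab : a < b) (haK : a ≤ numValues C0 C) :
    ordCost C0 C b < ordCost C0 C a := by
  rcases le_or_gt b (numValues C0 C) with hb | hb
  · have hb' : b - 1 < ((costValues C0 C).sort (· ≥ ·)).length := by
      rw [length_sort_costValues]
      omega
    rw [ordCost_eq_getElem hb', ordCost_eq_getElem (by omega)]
    exact List.pairwise_iff_getElem.1 (Finset.sortedGT_sort (costValues C0 C)).pairwise
      _ _ _ _ (by omega)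
  · rw [ordCost_of_gt hb]
    exact lt_ordCost ha haK

lemma ordCost_le {a b : ℕ} (ha : 1 ≤ a) (hab : a ≤ b) : ordCost C0 C b ≤ ordCost C0 C a := by
  rcases hab.eq_or_lt with rfl | h
  · exact le_rfl
  · rcases le_or_gt a (numValues C0 C) with haK | haK
    · exact (ordCost_lt ha h haK).le
    · rw [ordCost_of_gt haK, ordCost_of_gt (haK.trans h)]

lemma le_ordCost {k : ℕ} (h1 : 1 ≤ k) : C0 ≤ ordCost C0 C k := by
  rcases le_or_gt k (numValues C0 C) with hk | hk
  · exact (lt_ordCost h1 hk).le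
  · exact (ordCost_of_gt hk).ge

lemma ordCost_inj {a b : ℕ} (ha : 1 ≤ a) (hb : 1 ≤ b) (haK : a ≤ numValues C0 C)
    (hbK : b ≤ numValues C0 C) (h : ordCost C0 C a = ordCost C0 C b) : a = b := by
  rcases lt_trichotomy a b with hab | hab | hab
  · exact absurd h (ordCost_lt ha hab haK).ne'
  · exact hab
  · exact absurd h (ordCost_lt hb hab hbK).ne

lemma exists_ordCost_eq {e : E} (he : C0 < C e) :
    ∃ k, 1 ≤ k ∧ k ≤ numValues C0 C ∧ C e = ordCost C0 C k := by
  have h : C e ∈ (costValues C0 C).sort (· ≥ ·) := by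
    rw [Finset.mem_sort, costValues]
    exact Finset.mem_image_of_mem C (by simpa [Ebar] using he)
  obtain ⟨n, hn, heq⟩ := List.getElem_of_mem h
  refine ⟨n + 1, by omega, ?_, ?_⟩
  · rw [length_sort_costValues] at hn
    omega
  · rw [ordCost_eq_getElem (by simpa using hn)]
    exact heq.symm

lemma one_le_numValues (hE : (Ebar C0 C).Nonempty) : 1 ≤ numValues C0 C :=
  Finset.card_pos.2 (hE.image C)

lemma le_ordCost_one {e : E} : C e ≤ ordCost C0 C 1 := by
  rcases lt_or_ge C0 (C e) with he | he
  · obtain ⟨k, h1, -, heq⟩ := exists_ordCost_eq he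
    rw [heq]
    exact ordCost_le le_rfl h1
  · exact he.trans (le_ordCost le_rfl)

lemma mem_group {k : ℕ} {e : E} :
    e ∈ group C0 C k ↔ C0 < C e ∧ C e = ordCost C0 C k := by
  simp [group, Ebar]

lemma mem_topGroups_iff_lt [DecidableEq E] {i : ℕ} (hi : i ≤ numValues C0 C) {e : E} :
    e ∈ topGroups C0 C i ↔ ordCost C0 C (i + 1) < C e := by
  simp only [topGroups, Finset.mem_biUnion, Finset.mem_Icc, mem_group]
  constructor
  · rintro ⟨k, ⟨h1, hk⟩, -, heq⟩
    rw [heq]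
    exact ordCost_lt h1 (by omega) (by omega)
  · intro h
    have he : C0 < C e := (le_ordCost (by omega)).trans_lt h
    obtain ⟨k, h1, hk, heq⟩ := exists_ordCost_eq he
    refine ⟨k, ⟨h1, ?_⟩, he, heq⟩
    by_contra hlt
    rw [heq] at h
    exact (ordCost_le (by omega) (by omega)).not_gt h

lemma mem_topGroups_iff_le [DecidableEq E] {i : ℕ} (h1 : 1 ≤ i) (hi : i ≤ numValues C0 C) {e : E} :
    e ∈ topGroups C0 C i ↔ ordCost C0 C i ≤ C e := by
  rw [mem_topGroups_iff_lt hi]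
  constructor
  · intro h
    obtain ⟨k, hk1, hk, heq⟩ := exists_ordCost_eq ((le_ordCost (by omega)).trans_lt h)
    rw [heq] at h ⊢
    refine ordCost_le hk1 ?_
    by_contra hlt
    exact (ordCost_le (by omega) (by omega)).not_gt h
  · exact (ordCost_lt h1 (by omega) hi).trans_le

lemma topGroups_one [DecidableEq E] : topGroups C0 C 1 = group C0 C 1 := by
  simp [topGroups]

lemma sum_topGroups [DecidableEq E] {i : ℕ} (hi : i ≤ numValues C0 C) (g : ℝ → ℝ) :
    ∑ e ∈ topGroups C0 C i, g (C e)
      = ∑ k ∈ Finset.Icc 1 i, groupCard C0 C k * g (ordCost C0 C k) := by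
  rw [topGroups, Finset.sum_biUnion]
  · refine Finset.sum_congr rfl fun k _ => ?_
    rw [Finset.sum_congr rfl fun e he => by rw [(mem_group.1 he).2], Finset.sum_const,
      nsmul_eq_mul, groupCard]
  · intro a ha b hb hab
    rw [Finset.mem_coe, Finset.mem_Icc] at ha hb
    refine Finset.disjoint_left.2 fun e hea heb => hab ?_
    exact ordCost_inj ha.1 hb.1 (by omega) (by omega)
      ((mem_group.1 hea).2.symm.trans (mem_group.1 heb).2)

lemma groupCard_nonneg (k : ℕ) : 0 ≤ groupCard C0 C k := Nat.cast_nonneg _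

lemma groupCard_pos {k : ℕ} (h1 : 1 ≤ k) (hk : k ≤ numValues C0 C) : 0 < groupCard C0 C k := by
  obtain ⟨e, he⟩ := exists_eq_ordCost h1 hk
  rw [groupCard, Nat.cast_pos, Finset.card_pos]
  exact ⟨e, mem_group.2 he⟩

lemma invSum_eq_sum_topGroups [DecidableEq E] {i : ℕ} (hi : i ≤ numValues C0 C) :
    invSum C0 C i = ∑ e ∈ topGroups C0 C i, (C e - C0)⁻¹ := by
  rw [sum_topGroups hi fun x => (x - C0)⁻¹]
  rfl

lemma invAbove_ordCost [DecidableEq E] {j : ℕ} (h1 : 1 ≤ j) (hj : j ≤ numValues C0 C) :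
    invAbove C0 C (ordCost C0 C j - C0) = invSum C0 C j := by
  rw [invSum_eq_sum_topGroups hj, invAbove]
  refine Finset.sum_congr ?_ fun _ _ => rfl
  ext e
  simp [mem_topGroups_iff_le h1 hj]

lemma invStrictAbove_ordCost [DecidableEq E] {j : ℕ} (h1 : 1 ≤ j) (hj : j ≤ numValues C0 C) :
    invStrictAbove C0 C (ordCost C0 C j - C0) = invSum C0 C (j - 1) := by
  rw [invSum_eq_sum_topGroups (by omega), invStrictAbove]
  refine Finset.sum_congr ?_ fun _ _ => rfl
  ext e
  have : j - 1 + 1 = j := by omega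
  simp [mem_topGroups_iff_lt (show j - 1 ≤ numValues C0 C by omega), this]

/-- `i` is the number of groups whose damage exceeds `x`. -/
def IsLevel (C0 : ℝ) (C : E → ℝ) (i : ℕ) (x : ℝ) : Prop :=
  i ≤ numValues C0 C ∧ ordCost C0 C (i + 1) - C0 ≤ x ∧ (1 ≤ i → x < ordCost C0 C i - C0)

namespace IsLevel

variable {i : ℕ} {x : ℝ}

lemma nonneg (h : IsLevel C0 C i x) : 0 ≤ x :=
  (sub_nonneg.2 (le_ordCost (by omega))).trans h.2.1

lemma minEffort_of_mem [DecidableEq E] (h : IsLevel C0 C i x) {e : E} (he : e ∈ topGroups C0 C i) :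
    minEffort C0 C x e = 1 - x / (C e - C0) := by
  have h1 : 1 ≤ i := by
    rw [topGroups, Finset.mem_biUnion] at he
    obtain ⟨k, hk, -⟩ := he
    rw [Finset.mem_Icc] at hk
    omega
  rw [mem_topGroups_iff_le h1 h.1] at he
  exact minEffort_of_lt h.nonneg ((h.2.2 h1).trans_le (sub_le_sub_right he C0))

lemma minEffort_of_notMem [DecidableEq E] (h : IsLevel C0 C i x) {e : E} (he : e ∉ topGroups C0 C i) :
    minEffort C0 C x e = 0 := by
  rw [mem_topGroups_iff_lt h.1, not_lt] at he
  exact minEffort_of_le ((sub_le_sub_right he C0).trans h.2.1)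

/-- Bridge from `minEffort` to the group-wise formulas in the final statement. -/
lemma eq_minEffort_iff [DecidableEq E] (h : IsLevel C0 C i x) (ρ : E → ℝ) :
    ρ = minEffort C0 C x ↔
      (∀ k ∈ Finset.Icc 1 i, ∀ e ∈ group C0 C k,
        ρ e = (ordCost C0 C k - x - C0) / (ordCost C0 C k - C0)) ∧
      (∀ e, e ∉ topGroups C0 C i → ρ e = 0) := by
  have key : ∀ k ∈ Finset.Icc 1 i, ∀ e ∈ group C0 C k, minEffort C0 C x e
      = (ordCost C0 C k - x - C0) / (ordCost C0 C k - C0) := by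
    intro k hk e he
    rw [h.minEffort_of_mem (Finset.mem_biUnion.2 ⟨k, hk, he⟩), ← (mem_group.1 he).2]
    have : C e - C0 ≠ 0 := (sub_pos.2 (mem_group.1 he).1).ne'
    field_simp
    ring
  constructor
  · rintro rfl
    exact ⟨key, fun e he => h.minEffort_of_notMem he⟩
  · rintro ⟨h1, h2⟩
    funext e
    by_cases he : e ∈ topGroups C0 C i
    · obtain ⟨k, hk, hek⟩ := Finset.mem_biUnion.1 he
      rw [h1 k hk e hek, key k hk e hek]
    · rw [h2 e he, h.minEffort_of_notMem he]

lemma minTotal_eq [DecidableEq E] (h : IsLevel C0 C i x) :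
    minTotal C0 C x = ∑ k ∈ Finset.Icc 1 i, groupCard C0 C k - x * invSum C0 C i := by
  have h1 : minTotal C0 C x = ∑ e ∈ topGroups C0 C i, (1 - x / (C e - C0)) := by
    rw [minTotal, ← Finset.sum_subset (Finset.subset_univ (topGroups C0 C i))
      fun e _ he => h.minEffort_of_notMem he]
    exact Finset.sum_congr rfl fun e he => h.minEffort_of_mem he
  rw [h1, sum_topGroups h.1 fun y => 1 - x / (y - C0), invSum, Finset.mul_sum,
    ← Finset.sum_sub_distrib]
  exact Finset.sum_congr rfl fun k _ => by ring

/-- Levels count damage strictly above the threshold, so at `C_(j) - C0` group `j` stays unsecured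
and the level is `j - 1`. -/
lemma ordCost {j : ℕ} (h1 : 1 ≤ j) (hj : j ≤ numValues C0 C) :
    IsLevel C0 C (j - 1) (SecurityGame.ordCost C0 C j - C0) := by
  refine ⟨by omega, ?_, fun h => sub_lt_sub_right (ordCost_lt h (by omega) (by omega)) C0⟩
  rw [Nat.sub_add_cancel h1]

lemma unique {i' : ℕ} (h : IsLevel C0 C i x) (h' : IsLevel C0 C i' x) : i = i' := by
  by_contra hne
  wlog hlt : i < i' generalizing i i'
  · exact this h' h (Ne.symm hne) (by omega)
  · have h1 := h'.2.2 (by omega)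
    have h2 : SecurityGame.ordCost C0 C i' ≤ SecurityGame.ordCost C0 C (i + 1) :=
      ordCost_le (by omega) (by omega)
    have h3 := h.2.1
    linarith

end IsLevel

lemma exists_isLevel {x : ℝ} (hx : 0 ≤ x) (hx1 : x < ordCost C0 C 1 - C0) :
    ∃ i, 1 ≤ i ∧ IsLevel C0 C i x := by
  have hex : ∃ i, ordCost C0 C (i + 1) - C0 ≤ x :=
    ⟨numValues C0 C, by rw [ordCost_of_gt (by omega), sub_self]; exact hx⟩
  classical
  have h0 : Nat.find hex ≠ 0 := fun h => by
    have := Nat.find_spec hex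
    rw [h, zero_add] at this
    linarith
  refine ⟨Nat.find hex, by omega, Nat.find_min' hex ?_, Nat.find_spec hex, fun h => ?_⟩
  · rw [ordCost_of_gt (by omega), sub_self]
    exact hx
  · have := Nat.find_min hex (Nat.sub_lt (by omega) one_pos : Nat.find hex - 1 < Nat.find hex)
    rw [Nat.sub_add_cancel h] at this
    exact not_le.1 this

lemma invSum_nonneg (i : ℕ) : 0 ≤ invSum C0 C i :=
  Finset.sum_nonneg fun k hk => div_nonneg (groupCard_nonneg k)
    (sub_nonneg.2 (le_ordCost (Finset.mem_Icc.1 hk).1))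

lemma invSum_eq_add {j : ℕ} (h1 : 1 ≤ j) :
    invSum C0 C j = invSum C0 C (j - 1) + groupCard C0 C j / (ordCost C0 C j - C0) := by
  obtain ⟨n, rfl⟩ := Nat.exists_eq_add_of_le' h1
  rw [invSum, Finset.sum_Icc_succ_top (by omega), Nat.add_sub_cancel, invSum]

lemma invSum_pos {j : ℕ} (h1 : 1 ≤ j) (hj : j ≤ numValues C0 C) : 0 < invSum C0 C j := by
  rw [invSum_eq_add h1]
  exact add_pos_of_nonneg_of_pos (invSum_nonneg _)
    (div_pos (groupCard_pos h1 hj) (sub_pos.2 (lt_ordCost h1 hj)))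

lemma sum_groupCard_Icc_anti (i : ℕ) {a b : ℕ} (h : a ≤ b) :
    ∑ k ∈ Finset.Icc b i, groupCard C0 C k ≤ ∑ k ∈ Finset.Icc a i, groupCard C0 C k :=
  Finset.sum_le_sum_of_subset_of_nonneg (Finset.Icc_subset_Icc_left h)
    fun k _ _ => groupCard_nonneg k

lemma InPiece.unique_right {i j j' : ℕ} {x : ℝ} (h : InPiece C0 C i j x)
    (h' : InPiece C0 C i j' x) : j = j' := by
  by_contra hne
  wlog hlt : j < j' generalizing j j'
  · exact this h' h (Ne.symm hne) (by omega)
  · have h1 := div_le_div_of_nonneg_right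
      (sum_groupCard_Icc_anti (C0 := C0) (C := C) i (show j + 1 ≤ j' from hlt))
      (invSum_nonneg (C0 := C0) (C := C) i)
    have h2 := h.2.1
    have h3 := h'.2.2
    linarith

/-- Every group up to `i` has damage above `x`, so `x / (C_(k) - C0) < 1` in each summand. This
rules out `j = 0` in the search for the piece containing `x`. -/
lemma IsLevel.mul_invSum_lt {i : ℕ} {x : ℝ} (h1 : 1 ≤ i) (h : IsLevel C0 C i x) :
    x * invSum C0 C i < ∑ k ∈ Finset.Icc 1 i, groupCard C0 C k := by
  rw [invSum, Finset.mul_sum]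
  refine Finset.sum_lt_sum_of_nonempty (Finset.nonempty_Icc.2 h1) fun k hk => ?_
  rw [Finset.mem_Icc] at hk
  have hkK : k ≤ numValues C0 C := hk.2.trans h.1
  have hδ := sub_pos.2 (lt_ordCost hk.1 hkK)
  have hx : x < SecurityGame.ordCost C0 C k - C0 :=
    (h.2.2 h1).trans_le (sub_le_sub_right (ordCost_le hk.1 hk.2) C0)
  rw [mul_div_left_comm]
  exact mul_lt_of_lt_one_right (groupCard_pos hk.1 hkK) ((div_lt_one hδ).2 hx)

lemma exists_inPiece {x : ℝ} (hx : 0 ≤ x) (hx1 : x < ordCost C0 C 1 - C0) :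
    ∃ i j, 1 ≤ j ∧ j ≤ i ∧ IsLevel C0 C i x ∧ InPiece C0 C i j x := by
  obtain ⟨i, h1, hi⟩ := exists_isLevel hx hx1
  have hS := invSum_pos h1 hi.1
  -- `j = i` works because the sum is then empty; the least such `j` also satisfies the upper bound
  -- of the piece.
  have hex : ∃ j, (∑ k ∈ Finset.Icc (j + 1) i, groupCard C0 C k) / invSum C0 C i ≤ x :=
    ⟨i, by simpa using hx⟩
  classical
  have h0 : Nat.find hex ≠ 0 := fun h => by
    have := Nat.find_spec hex
    rw [h, zero_add, div_le_iff₀ hS] at this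
    exact this.not_gt (hi.mul_invSum_lt h1)
  refine ⟨i, Nat.find hex, by omega, Nat.find_min' hex (by simpa using hx), hi,
    ⟨hi.2.1, hi.2.2 h1⟩, Nat.find_spec hex, ?_⟩
  have := Nat.find_min hex (Nat.sub_lt (by omega) one_pos : Nat.find hex - 1 < Nat.find hex)
  rw [Nat.sub_add_cancel (by omega)] at this
  exact not_le.1 this

lemma cdTilde_eq {i j : ℕ} {x : ℝ} (h1 : 1 ≤ j) (hji : j ≤ i) (hi : IsLevel C0 C i x)
    (h : InPiece C0 C i j x) : cdTilde C0 C x = cdij C0 C i j x := by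
  rw [cdTilde, Finset.sum_eq_single i, Finset.sum_eq_single j, if_pos h]
  · intro j' _ hne
    rw [if_neg fun h' => hne (h'.unique_right h)]
  · intro hj
    exact absurd (Finset.mem_Icc.2 ⟨h1, hji⟩) hj
  · intro i' hi' hne
    refine Finset.sum_eq_zero fun j' _ => if_neg fun h' => hne ?_
    exact IsLevel.unique ⟨(Finset.mem_Icc.1 hi').2, h'.1.1, fun _ => h'.1.2⟩ hi
  · intro hi'
    exact absurd (Finset.mem_Icc.2 ⟨h1.trans hji, hi.1⟩) hi'

/-- Since `S_0 = 0`, one formula covers both branches. -/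
lemma cdij_eq {i j : ℕ} (h1 : 1 ≤ j) (x : ℝ) :
    cdij C0 C i j x = (ordCost C0 C j - C0) /
      ((ordCost C0 C j - C0) * invSum C0 C (j - 1) + ∑ k ∈ Finset.Icc j i, groupCard C0 C k
        - x * invSum C0 C i) := by
  have h : ∑ k ∈ Finset.Icc 1 i, x * groupCard C0 C k / (ordCost C0 C k - C0)
      = x * invSum C0 C i := by
    rw [invSum, Finset.mul_sum]
    exact Finset.sum_congr rfl fun k _ => mul_div_assoc _ _ _
  rw [cdij, h]
  split_ifs with hj
  · subst hj
    simp [invSum]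
  · rfl

lemma sum_groupCard_split {i j : ℕ} (h1 : 1 ≤ j) (hji : j ≤ i) :
    ∑ k ∈ Finset.Icc 1 i, groupCard C0 C k
      = ∑ k ∈ Finset.Icc 1 (j - 1), groupCard C0 C k + ∑ k ∈ Finset.Icc j i, groupCard C0 C k := by
  rw [← Finset.sum_union]
  · congr 1
    ext k
    simp only [Finset.mem_Icc, Finset.mem_union]
    omega
  · refine Finset.disjoint_left.2 fun k hk hk' => ?_
    rw [Finset.mem_Icc] at hk hk'
    omega

/-- At the defense cost `cdTilde C0 C x`, the threshold `x` without attack is as good as the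
optimal threshold with an attack. -/
lemma cdTilde_spec [DecidableEq E] {x : ℝ} (hx : 0 ≤ x) (hx1 : x < ordCost C0 C 1 - C0) :
    0 < cdTilde C0 C x ∧ ∃ j, 1 ≤ j ∧ j ≤ numValues C0 C ∧
      cdTilde C0 C x * invSum C0 C (j - 1) ≤ 1 ∧ 1 ≤ cdTilde C0 C x * invSum C0 C j ∧
      cdTilde C0 C x * minTotal C0 C x = (ordCost C0 C j - C0)
        + cdTilde C0 C x * minTotal C0 C (ordCost C0 C j - C0) := by
  obtain ⟨i, j, h1, hji, hi, hp⟩ := exists_inPiece hx hx1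
  have hjK : j ≤ numValues C0 C := hji.trans hi.1
  have hS := invSum_pos (h1.trans hji) hi.1
  have hδ := sub_pos.2 (lt_ordCost h1 hjK)
  have hlo := (div_le_iff₀ hS).1 hp.2.1
  have hhi := (lt_div_iff₀ hS).1 hp.2.2
  have hN := hi.minTotal_eq
  have hNj := (IsLevel.ordCost h1 hjK).minTotal_eq
  have hSj := invSum_eq_add (C0 := C0) (C := C) h1
  have hsplit := sum_groupCard_split (C0 := C0) (C := C) h1 hji
  have hfirst : ∑ k ∈ Finset.Icc j i, groupCard C0 C k
      = groupCard C0 C j + ∑ k ∈ Finset.Icc (j + 1) i, groupCard C0 C k := by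
    rw [← Finset.add_sum_Ioc_eq_sum_Icc hji, ← Finset.Icc_add_one_left_eq_Ioc]
  have hSnn := mul_nonneg hδ.le (invSum_nonneg (C0 := C0) (C := C) (j - 1))
  have hSj' : (ordCost C0 C j - C0) * invSum C0 C j
      = (ordCost C0 C j - C0) * invSum C0 C (j - 1) + groupCard C0 C j := by
    rw [hSj, mul_add, mul_div_cancel₀ _ hδ.ne']
  rw [cdTilde_eq h1 hji hi hp, cdij_eq h1]
  set D := (ordCost C0 C j - C0) * invSum C0 C (j - 1) + ∑ k ∈ Finset.Icc j i, groupCard C0 C k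
        - x * invSum C0 C i with hD
  have hDpos : 0 < D := by linarith
  -- After clearing denominators, the two bounds on `c` are the two bounds of the piece: `c *
  -- S_{j-1} ≤ 1` follows from `hhi`, and `1 ≤ c * S_j` from `hlo`.
  refine ⟨div_pos hδ hDpos, j, h1, hjK, ?_, ?_, ?_⟩
  · rw [div_mul_eq_mul_div, div_le_one hDpos]
    linarith
  · rw [div_mul_eq_mul_div, one_le_div hDpos]
    linarith
  -- The denominator of `cdij` is the effort saved by passing from threshold `x` to `C_(j) - C0`.
  · have : minTotal C0 C x = D + minTotal C0 C (ordCost C0 C j - C0) := by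
      rw [hN, hNj, hsplit, hD]
      ring
    rw [this, mul_add, div_mul_cancel₀ _ hDpos.ne']

end Ordering

/-! ### Deterrence versus tolerance in each regime -/

section Regimes

variable {E : Type*} [Fintype E] [DecidableEq E] {C0 : ℝ} {C : E → ℝ} {ca cd : ℝ}

/-- The threshold `C_(j) - C0` is optimal for a defense cost in `[1 / S_j, 1 / S_{j-1}]`. -/
lemma exists_isCertificate_ordCost {c : ℝ} {j : ℕ} (hc : 0 < c) (h1 : 1 ≤ j)
    (hj : j ≤ numValues C0 C) (hlo : c * invSum C0 C (j - 1) ≤ 1) (hhi : 1 ≤ c * invSum C0 C j) :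
    ∃ w, IsCertificate C0 C c (ordCost C0 C j - C0) w ∧
      (c * invSum C0 C (j - 1) < 1 → ∀ e, ordCost C0 C j - C0 ≤ C e - C0 → 0 < w e) ∧
      (1 < c * invSum C0 C j → ∀ e, C e - C0 ≤ ordCost C0 C j - C0 → w e * (C e - C0) < c) := by
  rw [← invStrictAbove_ordCost h1 hj] at hlo ⊢
  rw [← invAbove_ordCost h1 hj] at hhi ⊢
  exact exists_isCertificate (sub_pos.2 (lt_ordCost h1 hj)) hc (exists_sub_eq h1 hj) hlo hhi

/-- Below the threshold defense cost, deterring the attack is optimal. -/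
lemma deterrence_of_lt_cdTilde (hca : 0 < ca) (hcd : 0 < cd)
    (hca1 : ca < ordCost C0 C 1 - C0) (h : cd < cdTilde C0 C ca) (ρ : E → ℝ) (t : ℝ)
    (h0 : ∀ e, 0 ≤ ρ e) (ht : ∀ e, (1 - ρ e) * (C e - C0) ≤ t) (hat : ca < t) :
    cd * minTotal C0 C ca < t + cd * ∑ e, ρ e := by
  obtain ⟨hc, j, h1, hj, hlo, hhi, heq⟩ := cdTilde_spec hca.le hca1
  obtain ⟨w, hw, -, -⟩ := exists_isCertificate_ordCost hc h1 hj hlo hhi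
  have hle := hw.le_add_sum h0 ht
  rw [← heq] at hle
  set c := cdTilde C0 C ca
  -- At the critical cost `c`, the effort saved by tolerating the threat `t` is worth at most `t`;
  -- at the lower cost `cd` it is worth strictly less, or nothing is saved at all.
  have h2 : c * (minTotal C0 C ca - ∑ e, ρ e) ≤ t := by linarith
  suffices cd * (minTotal C0 C ca - ∑ e, ρ e) < t by linarith
  have htpos := hca.trans hat
  rcases le_or_gt (minTotal C0 C ca - ∑ e, ρ e) 0 with hs | hs
  · exact (mul_nonpos_of_nonneg_of_nonpos hcd.le hs).trans_lt htpos
  · exact (mul_lt_mul_of_pos_right h hs).trans_le h2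

/-- The threshold defense cost attains every value of the regimes of the second type. -/
lemma exists_cdTilde_eq {w : E → ℝ} {j : ℕ} (hcd : 0 < cd) (h1 : 1 ≤ j)
    (hj : j ≤ numValues C0 C) (hw : IsCertificate C0 C cd (ordCost C0 C j - C0) w)
    (hstrict : (ordCost C0 C j - C0) + cd * minTotal C0 C (ordCost C0 C j - C0)
      < cd * minTotal C0 C 0) :
    ∃ x ∈ Set.Ico 0 (ordCost C0 C 1 - C0), cdTilde C0 C x = cd := by
  have hδ := sub_pos.2 (lt_ordCost h1 hj)
  set d := ordCost C0 C j - C0 with hd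
  -- Choose `x` between `0` and `d` so that deterring at attack cost `x` costs exactly as much as
  -- optimal tolerance.
  obtain ⟨x, hx, hxeq⟩ := intermediate_value_Ioo' hδ.le
    (continuous_const.mul continuous_minTotal : Continuous fun t => cd * minTotal C0 C t).continuousOn
    (show d + cd * minTotal C0 C d ∈ Set.Ioo (cd * minTotal C0 C d) (cd * minTotal C0 C 0) from
      ⟨by linarith, hstrict⟩)
  change cd * minTotal C0 C x = d + cd * minTotal C0 C d at hxeq
  have hx1 : x < ordCost C0 C 1 - C0 :=
    hx.2.trans_le (sub_le_sub_right (ordCost_le le_rfl h1) C0)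
  refine ⟨x, ⟨hx.1.le, hx1⟩, ?_⟩
  obtain ⟨hc, k, hk1, hk, hlo, hhi, heq⟩ := cdTilde_spec hx.1.le hx1
  obtain ⟨v, hv, -, -⟩ := exists_isCertificate_ordCost hc hk1 hk hlo hhi
  have hδk := sub_pos.2 (lt_ordCost hk1 hk)
  have hle1 := hv.le_add_minTotal hδ.le
  have hle2 := hw.le_add_minTotal hδk.le
  set c := cdTilde C0 C x
  set δ := ordCost C0 C k - C0
  -- Cross-comparison: `δ` is optimal at cost `c` and `d` at cost `cd`. Testing each against the
  -- other's threshold and subtracting the two indifference equations at `x` gives both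
  -- inequalities.
  refine le_antisymm ?_ ?_
  · have h2 : 0 < minTotal C0 C x - minTotal C0 C d :=
      pos_of_mul_pos_right (by rw [mul_sub, hxeq]; linarith) hcd.le
    exact le_of_mul_le_mul_right (by rw [mul_sub, mul_sub]; linarith) h2
  · have h2 : 0 < minTotal C0 C x - minTotal C0 C δ :=
      pos_of_mul_pos_right (by rw [mul_sub, heq]; linarith) hc.le
    exact le_of_mul_le_mul_right (by rw [mul_sub, mul_sub]; linarith) h2

/-- In the regimes of the second type, `C_(j) - C0` is the only optimal threshold, and
tolerating the attack is cheaper than deterring it. -/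
lemma RegimeTwo.tolerance {j : ℕ} (h1 : 1 ≤ j) (hj : j ≤ numValues C0 C)
    (h : RegimeTwo C0 C j ca cd) (hcd : 0 < cd) :
    ca < ordCost C0 C j - C0 ∧
    (ordCost C0 C j - C0) + cd * minTotal C0 C (ordCost C0 C j - C0) < cd * minTotal C0 C ca ∧
    ∃ w, IsCertificate C0 C cd (ordCost C0 C j - C0) w ∧
      ∀ (ρ : E → ℝ) (t : ℝ), (∀ e, 0 ≤ ρ e) → (∀ e, (1 - ρ e) * (C e - C0) ≤ t) →
        t + cd * ∑ e, ρ e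
          ≤ (ordCost C0 C j - C0) + cd * minTotal C0 C (ordCost C0 C j - C0) →
        t = ordCost C0 C j - C0 ∧ ρ = minEffort C0 C (ordCost C0 C j - C0) := by
  obtain ⟨⟨hca, hinv⟩, hhi, hlo⟩ := h
  have hhi' : 1 < cd * invSum C0 C j := (inv_lt_iff_one_lt_mul₀ (invSum_pos h1 hj)).1 hhi
  have hlo' : cd * invSum C0 C (j - 1) < 1 := by
    rcases h1.eq_or_lt with rfl | h2
    · simp [invSum]
    · have h3 := hlo h2
      rwa [← one_div, lt_div_iff₀ (invSum_pos (by omega) (by omega))] at h3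
  obtain ⟨w, hw, hpos, hlt⟩ := exists_isCertificate_ordCost hcd h1 hj hlo'.le hhi'.le
  have hδ := sub_pos.2 (lt_ordCost h1 hj)
  have huniq := fun ρ t => hw.eq_of_add_sum_le (ρ := ρ) (t := t) hδ (exists_sub_eq h1 hj)
    (hpos hlo') (hlt hhi')
  set d := ordCost C0 C j - C0 with hd
  -- Threshold `0` is feasible with value `cd * minTotal C0 C 0`, and `d > 0` is the unique optimum.
  have hstrict : d + cd * minTotal C0 C d < cd * minTotal C0 C 0 := by
    by_contra hcon
    refine hδ.ne (huniq (minEffort C0 C 0) 0 (minEffort_nonneg 0)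
      (one_sub_minEffort_mul_le le_rfl) ?_).1
    rw [zero_add, ← minTotal]
    exact not_lt.1 hcon
  have hex := exists_cdTilde_eq hcd h1 hj hw hstrict
  -- Some preimage of `cd` is enough here; injectivity of `cdTilde` is not needed.
  have hmem := Function.invFunOn_mem hex
  have heq := Function.invFunOn_eq hex
  rw [← cdTildeInv] at hmem heq
  set x := cdTildeInv C0 C cd
  obtain ⟨-, k, hk1, hk, -, -, hspec⟩ := cdTilde_spec hmem.1 hmem.2
  rw [heq] at hspec
  have hle := hw.le_add_minTotal (sub_pos.2 (lt_ordCost hk1 hk)).le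
  rw [← hspec] at hle
  obtain ⟨e, he⟩ := exists_sub_eq (C0 := C0) (C := C) le_rfl (h1.trans hj)
  -- Since `ca < x < C_(1) - C0`, a facility of the top group witnesses that deterrence is strictly
  -- dearer at `ca` than at `x`.
  have hanti : minTotal C0 C x < minTotal C0 C ca :=
    minTotal_strictAnti (e := e) hca.le hinv (by rw [he]; exact hinv.trans hmem.2)
  have hH1 : d + cd * minTotal C0 C d < cd * minTotal C0 C ca :=
    hle.trans_lt (mul_lt_mul_of_pos_left hanti hcd)
  refine ⟨?_, hH1, w, hw, huniq⟩
  by_contra hcon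
  have := mul_le_mul_of_nonneg_left (minTotal_anti (C0 := C0) (C := C) hδ.le (not_lt.1 hcon)) hcd.le
  linarith

/-- The equilibria in the regimes of the second type. -/
lemma RegimeTwo.equilibria {j : ℕ} (h1 : 1 ≤ j) (hj : j ≤ numValues C0 C)
    (h : RegimeTwo C0 C j ca cd) (hcd : 0 < cd) :
    (∃! ρ : E → ℝ, ρ ∈ speEfforts C0 C ca cd) ∧
    speEfforts C0 C ca cd = neEfforts C0 C ca cd ∧
    ∀ (σd : DefStrategy E) (σa : DefStrategy E → AttStrategy E),
      IsSPE C0 C ca cd σd σa ↔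
        effort σd = minEffort C0 C (ordCost C0 C j - C0) ∧
        AttacksWithin (σa σd) (topGroups C0 C j) ∧
        (∀ σd' : DefStrategy E, σd' ≠ σd → σa σd' ∈ BR C0 C ca σd') := by
  obtain ⟨had, hH1, w, hw, hH3⟩ := h.tolerance h1 hj hcd
  have hca : 0 < ca := h.1.1
  have hex := exists_sub_eq h1 hj
  have hd := hca.trans had
  have htop : topGroups C0 C j
      = Finset.univ.filter fun e => ordCost C0 C j - C0 ≤ C e - C0 := by
    ext e
    simp [mem_topGroups_iff_le h1 hj]
  have hiff := isSPE_iff_of_tolerance hca hcd had hex hH1 (fun ρ t => hw.le_add_sum) hH3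
  rw [← htop] at hiff
  obtain ⟨σs, hσs⟩ := exists_effort_eq_minEffort C0 C hd.le
  have hNE := hw.isNE hca had hex hσs
  have hspe := speEfforts_eq_singleton (P := fun τ => AttacksWithin τ (topGroups C0 C j))
    ⟨σs, hσs⟩ ⟨_, htop ▸ (mem_BR_iff_attacksWithin hca had hex hσs _).1 hNE.2⟩ hiff
  refine ⟨existsUnique_mem_of_eq_singleton hspe, ?_, hiff⟩
  rw [hspe]
  ext ρ
  rw [Set.mem_singleton_iff]
  constructor
  · rintro rfl
    exact ⟨σs, _, hNE, hσs⟩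
  · rintro ⟨σd, τ, hτ, rfl⟩
    exact effort_eq_of_isNE hw hca had hex hH1 hcd hH3 hτ

end Regimes

end SecurityGame

/-! ### The theorem -/

open SecurityGame in
theorem theorem2 {E : Type*} [Fintype E] [DecidableEq E] (C0 : ℝ) (C : E → ℝ) (ca cd : ℝ)
    (hca : 0 < ca) (hcd : 0 < cd) (hE : (Ebar C0 C).Nonempty) :
    -- regime `i = 0` of the first type
    (RegimeOneZero C0 C ca cd →
      (∃! ρ : E → ℝ, ρ ∈ speEfforts C0 C ca cd) ∧
      ∀ (σd : DefStrategy E) (σa : DefStrategy E → AttStrategy E),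
        IsSPE C0 C ca cd σd σa ↔
          (∀ e, effort σd e = 0) ∧
          (∀ σd' : DefStrategy E, (σa σd').1 none = 1)) ∧
    -- regimes `i = 1, …, K` of the first type
    (∀ i ∈ Finset.Icc 1 (numValues C0 C), RegimeOne C0 C i ca cd →
      (∃! ρ : E → ℝ, ρ ∈ speEfforts C0 C ca cd) ∧
      ∀ (σd : DefStrategy E) (σa : DefStrategy E → AttStrategy E),
        IsSPE C0 C ca cd σd σa ↔
          (∀ k ∈ Finset.Icc 1 i, ∀ e ∈ group C0 C k,
            effort σd e = (ordCost C0 C k - ca - C0) / (ordCost C0 C k - C0)) ∧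
          (∀ e, e ∉ topGroups C0 C i → effort σd e = 0) ∧
          (σa σd).1 none = 1 ∧
          (∀ σd' : DefStrategy E, σd' ≠ σd → σa σd' ∈ BR C0 C ca σd')) ∧
    -- regime `j = 1` of the second type
    (RegimeTwo C0 C 1 ca cd →
      (∃! ρ : E → ℝ, ρ ∈ speEfforts C0 C ca cd) ∧
      speEfforts C0 C ca cd = neEfforts C0 C ca cd ∧
      ∀ (σd : DefStrategy E) (σa : DefStrategy E → AttStrategy E),
        IsSPE C0 C ca cd σd σa ↔
          (∀ e, effort σd e = 0) ∧
          AttacksWithin (σa σd) (group C0 C 1) ∧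
          (∀ σd' : DefStrategy E, σd' ≠ σd → σa σd' ∈ BR C0 C ca σd')) ∧
    -- regimes `j = 2, …, K` of the second type
    (∀ j ∈ Finset.Icc 2 (numValues C0 C), RegimeTwo C0 C j ca cd →
      (∃! ρ : E → ℝ, ρ ∈ speEfforts C0 C ca cd) ∧
      speEfforts C0 C ca cd = neEfforts C0 C ca cd ∧
      ∀ (σd : DefStrategy E) (σa : DefStrategy E → AttStrategy E),
        IsSPE C0 C ca cd σd σa ↔
          (∀ k ∈ Finset.Icc 1 (j - 1), ∀ e ∈ group C0 C k,
            effort σd e = (ordCost C0 C k - ordCost C0 C j) / (ordCost C0 C k - C0)) ∧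
          (∀ e, e ∉ topGroups C0 C (j - 1) → effort σd e = 0) ∧
          AttacksWithin (σa σd) (topGroups C0 C j) ∧
          (∀ σd' : DefStrategy E, σd' ≠ σd → σa σd' ∈ BR C0 C ca σd')) := by
  refine ⟨?_, ?_, ?_, ?_⟩
  · rintro ⟨hca1, -⟩
    have hlow : ∀ e, C e - C0 < ca := fun e =>
      (sub_le_sub_right le_ordCost_one C0).trans_lt hca1
    have hmin : minEffort C0 C ca = 0 := funext fun e => minEffort_of_le (hlow e).le
    -- No defense leaves a threat above `C_(1) - C0 < ca`, so "no attack" is the only best response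
    -- even off the path.
    have hfeas : ∀ (σd : DefStrategy E) e, (1 - effort σd e) * (C e - C0)
        ≤ ordCost C0 C 1 - C0 := by
      intro σd e
      have h1 : C e - C0 ≤ ordCost C0 C 1 - C0 := sub_le_sub_right le_ordCost_one C0
      have h2 : 0 ≤ ordCost C0 C 1 - C0 := sub_nonneg.2 (le_ordCost le_rfl)
      exact (mul_le_mul_of_nonneg_left h1 (sub_nonneg.2 (effort_le_one σd e))).trans
        (mul_le_of_le_one_left h2 (sub_le_self _ (effort_nonneg σd e)))
    have H : ∀ (ρ : E → ℝ) (t : ℝ), (∀ e, 0 ≤ ρ e) → (∀ e, (1 - ρ e) * (C e - C0) ≤ t) →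
        ca < t → cd * minTotal C0 C ca < t + cd * ∑ e, ρ e := by
      intro ρ t h0 _ hat
      have h1 : minTotal C0 C ca = 0 := by simp [minTotal, hmin]
      rw [h1, mul_zero]
      exact add_pos_of_pos_of_nonneg (hca.trans hat)
        (mul_nonneg hcd.le (Finset.sum_nonneg fun e _ => h0 e))
    have hBR : ∀ (σd : DefStrategy E) (τ : AttStrategy E),
        τ ∈ BR C0 C ca σd → τ.1 none = 1 := fun σd τ hτ =>
      (expLoss_eq_zero_of_lt hτ hca1 (hfeas σd)).1
    refine ⟨existsUnique_mem_of_eq_singleton (speEfforts_of_deterrence hca hcd H),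
      fun σd σa => ?_⟩
    constructor
    · intro h
      have h1 := (isSPE_iff_of_deterrence hca hcd H σd σa).1 h
      refine ⟨fun e => by rw [h1.1, hmin]; rfl, fun σd' => hBR σd' _ ?_⟩
      exact ((isSPE_iff_mem_BR σa).1 h).1 σd'
    · rintro ⟨h1, h2⟩
      refine (isSPE_iff_of_deterrence hca hcd H σd σa).2
        ⟨by rw [hmin]; exact funext h1, h2 σd, fun σd' _ => ?_⟩
      rw [mem_BR_iff, sum_attackGain, expLoss_eq_zero (h2 σd'), h2 σd']
      rintro (_ | e)
      · simp [attackGain]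
      · have := hfeas σd' e
        simp only [attackGain]
        linarith
  · rintro i hi ⟨⟨h1, h2⟩, -, h3⟩
    rw [Finset.mem_Icc] at hi
    have hlevel : IsLevel C0 C i ca := ⟨hi.2, h1.le, fun _ => h2⟩
    have H := deterrence_of_lt_cdTilde hca hcd
      (h2.trans_le (sub_le_sub_right (ordCost_le le_rfl hi.1) C0)) h3
    refine ⟨existsUnique_mem_of_eq_singleton (speEfforts_of_deterrence hca hcd H),
      fun σd σa => ?_⟩
    rw [isSPE_iff_of_deterrence hca hcd H, hlevel.eq_minEffort_iff, and_assoc]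
  · intro h
    have hK := one_le_numValues hE
    obtain ⟨h1, h2, h3⟩ := h.equilibria le_rfl hK hcd
    refine ⟨h1, h2, fun σd σa => ?_⟩
    -- For `j = 1` the level is `0`: the group-wise formulas are vacuous and all efforts vanish.
    rw [h3, (IsLevel.ordCost le_rfl hK).eq_minEffort_iff, topGroups_one]
    simp [topGroups]
  · intro j hj h
    rw [Finset.mem_Icc] at hj
    have hj1 : 1 ≤ j := by omega
    obtain ⟨h1, h2, h3⟩ := h.equilibria hj1 hj.2 hcd
    refine ⟨h1, h2, fun σd σa => ?_⟩
    rw [h3, (IsLevel.ordCost hj1 hj.2).eq_minEffort_iff, and_assoc]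
    simp only [sub_sub, sub_add_cancel]
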